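/- Let $\mathcal H_S$ be a Hilbert space of finite dimension $d$, let $\hbar,k_B,T>0$, $\tau\ge 0$, $\beta=1/(k_BT)$, and let $t\mapsto H(t)$, $t\in[0,\tau]$, be an integrable family of self-adjoint operators on $\mathcal H_S$; put $H_0=H(0)$, $H_\tau=H(\tau)$. Let $\Theta$ be an anti-unitary operator on $\mathcal H_S$ (time reversal). Let $$U(t,s)=\overrightarrow{\mathbf T}\exp\Bigl[-\tfrac{i}{\hbar}\int_s^tH(t')\,dt'\Bigr],\qquad \tilde U(t,0)=\overrightarrow{\mathbf T}\exp\Bigl[-\tfrac{i}{\hbar}\int_0^t\Theta H(\tau-t')\Theta^\dagger\,dt'\Bigr]$$ (Dyson series) be the forward and time-reversed evolution operators. For $x\in\{0,\tau\}$ let $F_x=-\beta^{-1}\log\operatorname{Tr}e^{-\beta H_x}$ be the free energy and $\rho_x^{\rm th}=e^{-\beta(H_x-F_x)}$ the thermal state. Average dissipative work. Let $(|E^{(0)}_n\rangle)_n$ and $(|E^{(\tau)}_m\rangle)_m$ be orthonormal eigenbases of $H_0$ and $H_\tau$ with eigenvalues $E_n^{(0)}$, $E_m^{(\tau)}$. The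 work distribution in the two-point measurement scheme is $$P(W)=\sum_{m,n}e^{-\beta(E^{(0)}_n-F_0)}\,\bigl|\langle E_m^{(\tau)}|U(\tau,0)|E_n^{(0)}\rangle\bigr|^2\,\delta\bigl(W-(E_m^{(\tau)}-E_n^{(0)})\bigr),$$ and $\langle W_{\rm diss}\rangle=\int (W-\Delta F)\,dP(W)$ with $\Delta F=F_\tau-F_0$. Visibility. Let $|\psi\rangle,|\tilde\psi\rangle$ be vectors in $\mathcal H_S\otimes\mathcal H_E$, for an arbitrary environment Hilbert space $\mathcal H_E$, that purify the two thermal states: $\operatorname{Tr}_E|\psi\rangle\langle\psi|=\rho_0^{\rm th}$ and $\operatorname{Tr}_E|\tilde\psi\rangle\langle\tilde\psi|=\rho_\tau^{\rm th}$. A path qubit $A$, prepared in $(|0\rangle+|1\rangle)/\sqrt2$, is entangled with the system and the environment to give $$\tfrac1{\sqrt2}\bigl(|0\rangle_A\otimes|\phi_0\rangle+|1\rangle_A\otimes|\phi_1\rangle\bigr),\quad |\phi_0\rangle=\bigl(U(\tfrac\tau2,0)\otimes\mathbb 1_E\bigr)|\psi\rangle,\quad |\phi_1\rangle=\bigl(\Theta^\dagger\tilde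 U(\tfrac\tau2,0)\Theta\otimes\mathbb 1_E\bigr)|\tilde\psi\rangle,$$ and the visibility is $\mathcal V=2\,|\langle0|\rho_A|1\rangle|=\bigl|\operatorname{Tr}_{S,E}|\phi_0\rangle\langle\phi_1|\bigr|$, where $\rho_A$ is the reduced state of $A$. Then, with $\alpha$ the smallest eigenvalue of $\rho_\tau^{\rm th}$ and $\log$ the natural logarithm, $$\langle W_{\rm diss}\rangle\le k_BT\,\frac{4(1-\mathcal V^2)}{\alpha}\qquad\text{and}\qquad\langle W_{\rm diss}\rangle\le k_BT\Bigl[\sqrt{1-\mathcal V^2}\,\log\frac{d^2}{\alpha}+e^{-1}\Bigr].$$ -/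

import Mathlib

open scoped TensorProduct InnerProductSpace ComplexConjugate

noncomputable section

namespace WorkInterferometry

variable {S E : Type*} [NormedAddCommGroup S] [InnerProductSpace ℂ S]
  [NormedAddCommGroup E] [InnerProductSpace ℂ E]

/-! ### Dynamics: time-ordered exponential and time reversal -/

/-- The `n`-th term of the Dyson series of the Hamiltonian `H` from time `s` to time `t`:
`(-i/ℏ)ⁿ ∫_{s ≤ t₁ ≤ … ≤ tₙ ≤ t} H(tₙ) ⋯ H(t₁) dt₁ ⋯ dtₙ`. -/
def dysonTerm (ℏ : ℝ) (H : ℝ → S →L[ℂ] S) (s : ℝ) : ℕ → ℝ → S →L[ℂ] S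
  | 0, _ => 1
  | n + 1, t => (-Complex.I / (ℏ : ℂ)) • ∫ r in s..t, H r * dysonTerm ℏ H s n r

/-- The evolution operator `U(t, s) = T→ exp (-(i/ℏ) ∫ₛᵗ H(t') dt')`, as a Dyson series. -/
def evolution (ℏ : ℝ) (H : ℝ → S →L[ℂ] S) (t s : ℝ) : S →L[ℂ] S :=
  ∑' n, dysonTerm ℏ H s n t

/-- The (complex linear) operator `Θ A Θ†` for an anti-unitary operator `Θ`, whose adjoint `Θ†`
is its inverse. -/
def antiConj (Θ : S ≃ₗᵢ⋆[ℂ] S) (A : S →L[ℂ] S) : S →L[ℂ] S :=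
  (Θ.toContinuousLinearEquiv : S →SL[starRingEnd ℂ] S).comp
    (A.comp (Θ.symm.toContinuousLinearEquiv : S →SL[starRingEnd ℂ] S))

theorem antiConj_apply (Θ : S ≃ₗᵢ⋆[ℂ] S) (A : S →L[ℂ] S) (x : S) :
    antiConj Θ A x = Θ (A (Θ.symm x)) := rfl

/-- The Hamiltonian `t ↦ Θ H(τ - t) Θ†` driving the time-reversed process. -/
def reversedHamiltonian (Θ : S ≃ₗᵢ⋆[ℂ] S) (τ : ℝ) (H : ℝ → S →L[ℂ] S) (t : ℝ) : S →L[ℂ] S :=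
  antiConj Θ (H (τ - t))

/-! ### Thermal states and work -/

/-- The free energy `F = -β⁻¹ log Tr e^{-β H}`. -/
def freeEnergy (β : ℝ) (H : S →L[ℂ] S) : ℝ :=
  -β⁻¹ * Real.log
    (LinearMap.trace ℂ S (NormedSpace.exp ((-β : ℂ) • H) : S →L[ℂ] S).toLinearMap).re

/-- The thermal state `exp (-β (H - F))`. -/
def thermalState (β : ℝ) (H : S →L[ℂ] S) : S →L[ℂ] S :=
  NormedSpace.exp ((-β : ℂ) • (H - (freeEnergy β H : ℂ) • (1 : S →L[ℂ] S)))

/-- The work distribution of the two-point measurement scheme,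
`P(W) = ∑ₙₘ pₙ |⟨fₘ|U|eₙ⟩|² δ(W - (ε'ₘ - εₙ))` with `pₙ = exp (-β (εₙ - F₀))`, for the
initial energy eigenbasis `e` with energies `ε`, initial free energy `F₀`, final energy
eigenbasis `f` with energies `ε'`, and evolution operator `U`. -/
def workDistribution {ι : Type*} [Fintype ι] (β F₀ : ℝ) (e f : OrthonormalBasis ι ℂ S)
    (ε ε' : ι → ℝ) (U : S →L[ℂ] S) : MeasureTheory.Measure ℝ :=
  ∑ n, ∑ m, ENNReal.ofReal (Real.exp (-β * (ε n - F₀)) * ‖⟪f m, U (e n)⟫_ℂ‖ ^ 2) •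
    MeasureTheory.Measure.dirac (ε' m - ε n)

/-- The average of the dissipative work `W_diss = W - ΔF` under the work distribution `P`. -/
def avgDissipativeWork (P : MeasureTheory.Measure ℝ) (ΔF : ℝ) : ℝ :=
  ∫ W, (W - ΔF) ∂P

/-! ### Purifications -/

/-- The partial inner product `⟨x| ⊗ 1 : S ⊗ E → E`. -/
def contract (x : S) : S ⊗[ℂ] E →ₗ[ℂ] E :=
  (TensorProduct.lid ℂ E).toLinearMap ∘ₗ LinearMap.rTensor E (innerSL ℂ x).toLinearMap

theorem contract_tmul (x v : S) (w : E) : contract x (v ⊗ₜ[ℂ] w) = ⟪x, v⟫_ℂ • w := by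
  simp [contract]

/-- `ψ ∈ S ⊗ E` is a purification of the operator `ρ` on `S`, i.e. `Tr_E |ψ⟩⟨ψ| = ρ`: the matrix
element `⟨x| Tr_E(|ψ⟩⟨ψ|) |y⟩` is the inner product of `(⟨y| ⊗ 1)ψ` and `(⟨x| ⊗ 1)ψ`; see
`isPurification_iff` for the expression in an orthonormal basis of `E`. -/
def IsPurification (ψ : S ⊗[ℂ] E) (ρ : S →L[ℂ] S) : Prop :=
  ∀ x y : S, ⟪x, ρ y⟫_ℂ = ⟪contract y ψ, contract x ψ⟫_ℂ

theorem inner_contract (x : S) (w : E) (ψ : S ⊗[ℂ] E) :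
    ⟪w, contract x ψ⟫_ℂ = ⟪x ⊗ₜ[ℂ] w, ψ⟫_ℂ := by
  induction ψ with
  | zero => simp
  | tmul v u => simp [contract_tmul]
  | add a b ha hb => simp [inner_add_right, ha, hb]

/-- In an orthonormal basis `b` of the environment, `ψ` purifies `ρ` iff
`⟨x|ρ|y⟩ = ∑ₖ ⟨x ⊗ bₖ|ψ⟩⟨ψ|y ⊗ bₖ⟩`. -/
theorem isPurification_iff {κ : Type*} [Fintype κ] (b : OrthonormalBasis κ ℂ E)
    (ψ : S ⊗[ℂ] E) (ρ : S →L[ℂ] S) :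
    IsPurification ψ ρ ↔
      ∀ x y : S, ⟪x, ρ y⟫_ℂ = ∑ k, ⟪x ⊗ₜ[ℂ] b k, ψ⟫_ℂ * ⟪ψ, y ⊗ₜ[ℂ] b k⟫_ℂ := by
  refine forall₂_congr fun x y => ?_
  rw [← b.sum_inner_mul_inner (contract y ψ) (contract x ψ)]
  refine Eq.congr_right (Finset.sum_congr rfl fun k _ => ?_)
  rw [inner_contract, ← inner_conj_symm (contract y ψ), inner_contract, mul_comm]
  exact congrArg _ (inner_conj_symm (𝕜 := ℂ) ψ (y ⊗ₜ[ℂ] b k))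

/-! ### The interferometer -/

/-- The local action `A ⊗ 1_E` of an operator on the system. -/
def onSystem (A : S →L[ℂ] S) : S ⊗[ℂ] E →ₗ[ℂ] S ⊗[ℂ] E :=
  LinearMap.rTensor E A.toLinearMap

/-- The state at the output of path `0`, i.e. `(U(τ/2, 0) ⊗ 1_E)|ψ⟩`. -/
def pathZero (ℏ τ : ℝ) (H : ℝ → S →L[ℂ] S) (ψ : S ⊗[ℂ] E) : S ⊗[ℂ] E :=
  onSystem (evolution ℏ H (τ / 2) 0) ψ

/-- The state at the output of path `1`, i.e. `(Θ† Ũ(τ/2, 0) Θ ⊗ 1_E)|ψ'⟩`, where `Ũ` is the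
evolution operator of the time-reversed process. -/
def pathOne (ℏ τ : ℝ) (Θ : S ≃ₗᵢ⋆[ℂ] S) (H : ℝ → S →L[ℂ] S) (ψ' : S ⊗[ℂ] E) : S ⊗[ℂ] E :=
  onSystem (antiConj Θ.symm (evolution ℏ (reversedHamiltonian Θ τ H) (τ / 2) 0)) ψ'

/-- The state `(|0⟩ ⊗ φ₀ + |1⟩ ⊗ φ₁)/√2` of the path qubit, the system and the environment,
given by its two components along the path basis. -/
def jointState (φ₀ φ₁ : S ⊗[ℂ] E) : Fin 2 → S ⊗[ℂ] E :=
  fun a => (((√2 : ℝ) : ℂ)⁻¹) • (![φ₀, φ₁] a)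

/-- The reduced density matrix `⟨a|ρ_A|b⟩ = ⟨a| Tr_{S,E} |Ψ⟩⟨Ψ| |b⟩` of the path qubit. -/
def pathDensity (Ψ : Fin 2 → S ⊗[ℂ] E) : Matrix (Fin 2) (Fin 2) ℂ :=
  Matrix.of fun a b => ⟪Ψ b, Ψ a⟫_ℂ

/-- The fringe visibility `2 |⟨0|ρ_A|1⟩|` for a path qubit with density matrix `ρ_A` (and equal
weights of the two paths). -/
def visibility (ρA : Matrix (Fin 2) (Fin 2) ℂ) : ℝ := 2 * ‖ρA 0 1‖

/-- The visibility is `|Tr_{S,E} |φ₀⟩⟨φ₁|| = |⟨φ₁|φ₀⟩|`. -/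
theorem visibility_jointState (φ₀ φ₁ : S ⊗[ℂ] E) :
    visibility (pathDensity (jointState φ₀ φ₁)) = ‖⟪φ₁, φ₀⟫_ℂ‖ := by
  have h : (√2 : ℝ)⁻¹ * (√2 : ℝ)⁻¹ = 2⁻¹ := by
    rw [← mul_inv, Real.mul_self_sqrt (by norm_num)]
  have h' : pathDensity (jointState φ₀ φ₁) 0 1
      = (((√2 : ℝ)⁻¹ * (√2 : ℝ)⁻¹ : ℝ) : ℂ) * ⟪φ₁, φ₀⟫_ℂ := by
    refine (inner_smul_left (𝕜 := ℂ) φ₁ ((((√2 : ℝ) : ℂ)⁻¹) • φ₀) (((√2 : ℝ) : ℂ)⁻¹)).trans ?_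
    refine (congrArg _ (inner_smul_right (𝕜 := ℂ) φ₁ φ₀ (((√2 : ℝ) : ℂ)⁻¹))).trans ?_
    rw [map_inv₀, Complex.conj_ofReal]
    push_cast
    ring
  rw [visibility, h', h, norm_mul, Complex.norm_real]
  norm_num
  ring

end WorkInterferometry

end

/-!
The dissipative work is a relative entropy, and the visibility is the overlap of two purifications
of the states it compares, so both bounds are continuity estimates for the relative entropy.

*Dynamics.* For an integrable Hamiltonian the Dyson series converges, the propagators `U(t, s)`
satisfy the integral equation `U(t, s) = 1 + ∫ₛᵗ A(r) U(r, s) dr` with `A = -(i/ℏ) H`, whose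
solution is unique, so they compose, and for symmetric `H` they are isometric. Conjugating each Dyson
term of the reversed process by `Θ` shows `Θ† Ũ(τ/2, 0) Θ = U(τ/2, τ)`
(`antiConj_symm_evolution_reversed`), so the two paths of the interferometer carry purifications of
`ρ = U(τ/2, 0) ρ₀ U(τ/2, 0)†` and `σ = U(τ/2, τ) ρ_τ U(τ/2, τ)†`. Since
`U(τ/2, τ) U(τ, 0) = U(τ/2, 0)`, the two-point measurement statistics are
`p i * |⟪v j, u i⟫|²` for eigenbases `u`, `v` of `ρ`, `σ` with eigenvalues `p`, `q`, and
`β ⟨W_diss⟩ = ∑ p i * |⟪v j, u i⟫|² * (log (p i) - log (q j)) = Tr ρ (log ρ - log σ)`.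

*Visibility.* Write `δ = √(1 - V²)`. A pure-state estimate and Parseval's identity for partial inner
products give `‖ρ - σ‖₁ ≤ 2 δ`, tested in any orthonormal basis (`sum_abs_sub_le_of_overlap`).

*Entropy.* From `log x ≤ x - 1` the relative entropy is at most the `χ²`-divergence, hence at most
`‖ρ - σ‖₂² / α ≤ 4 δ² / α` (`relativeEntropy_le_chiSq`, `sum_sum_sq_sub_le`). For the second bound
the relative entropy is split as `S(σ) - S(ρ) - Tr (ρ - σ) log σ`. The last term is at most
`δ log (1/α)` because `-log σ` has spectrum in `[0, -log α]` and `ρ - σ` is traceless, and the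
entropy difference is at most `2 δ log d + 1/e` by Fannes' inequality (`entropy_sub_le`), which is
proved directly from Klein's inequality with a suitable comparison state.
-/

noncomputable section

namespace WorkInterferometry

section Dynamics

open MeasureTheory Set

/-! ### Volterra estimates for integrable kernels -/

/-- Absolute continuity is inherited by functions whose increments are dominated. -/
theorem absolutelyContinuousOnInterval_of_dist_le {X Y : Type*} [PseudoMetricSpace X]
    [PseudoMetricSpace Y] {f : ℝ → X} {g : ℝ → Y} {a b C : ℝ}
    (hg : AbsolutelyContinuousOnInterval g a b)
    (h : ∀ x ∈ uIcc a b, ∀ y ∈ uIcc a b, dist (f x) (f y) ≤ C * dist (g x) (g y)) :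
    AbsolutelyContinuousOnInterval f a b := by
  unfold AbsolutelyContinuousOnInterval at hg ⊢
  refine squeeze_zero' ?_ ?_ (by simpa using hg.const_mul C)
  · exact Filter.Eventually.of_forall fun _ => Finset.sum_nonneg fun _ _ => dist_nonneg
  · rw [Filter.eventually_inf_principal]
    refine Filter.Eventually.of_forall fun E hE => ?_
    rw [Finset.mul_sum]
    refine Finset.sum_le_sum fun i hi => ?_
    have := hE.1 i (by simpa using hi)
    exact h _ this.1 _ this.2

/-- The chain rule `∫ G' Gⁿ = Gⁿ⁺¹ / (n + 1)` for a primitive `G` of a merely integrable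
function. -/
theorem integral_mul_primitive_pow {k : ℝ → ℝ} (hk : Integrable k) (s t : ℝ) (n : ℕ) :
    ∫ r in s..t, k r * (∫ x in s..r, k x) ^ n = (∫ x in s..t, k x) ^ (n + 1) / (n + 1) := by
  set G : ℝ → ℝ := fun r => ∫ x in s..r, k x with hG
  have hGc : Continuous G := hk.continuous_primitive s
  have hkG : LocallyIntegrable (fun r => k r * G r ^ n) :=
    hk.locallyIntegrable.mul_continuous (hGc.pow n)
  have hkGi : IntervalIntegrable (fun r => k r * G r ^ n) volume s t :=
    hk.intervalIntegrable.mul_continuousOn (hGc.pow n).continuousOn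
  have hGac : AbsolutelyContinuousOnInterval G s t :=
    hk.intervalIntegrable.absolutelyContinuousOnInterval_intervalIntegral left_mem_uIcc
  have hpow : ∀ m : ℕ, AbsolutelyContinuousOnInterval (fun r => G r ^ (m + 1)) s t := by
    intro m
    induction m with
    | zero => simpa using hGac
    | succ m ih =>
      have := ih.fun_mul hGac
      simpa only [← pow_succ] using this
  have hφ := (hkGi.absolutelyContinuousOnInterval_intervalIntegral left_mem_uIcc).sub
    ((hpow n).const_mul ((n + 1 : ℝ)⁻¹))
  obtain ⟨C, hC⟩ := hφ.const_of_ae_hasDerivAt_zero (by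
    filter_upwards [LocallyIntegrable.ae_hasDerivAt_integral hkG,
      LocallyIntegrable.ae_hasDerivAt_integral hk.locallyIntegrable]
      with x h1 h2 _
    have h3 := (h1 s).sub (((h2 s).pow (n + 1)).const_mul ((n + 1 : ℝ)⁻¹))
    refine h3.congr_deriv ?_
    have : (n + 1 : ℝ) ≠ 0 := by positivity
    simp only [hG, add_tsub_cancel_right, Nat.cast_add, Nat.cast_one]
    field_simp
    ring)
  have h1 := hC s left_mem_uIcc
  have h2 := hC t right_mem_uIcc
  simp only [Pi.sub_apply, intervalIntegral.integral_same, hG] at h1 h2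
  rw [zero_pow n.succ_ne_zero] at h1
  rw [div_eq_inv_mul]
  linarith

theorem abs_primitive_norm_le {F : Type*} [NormedAddCommGroup F] {A : ℝ → F}
    (hA : Integrable A) (s t : ℝ) :
    |∫ x in s..t, ‖A x‖| ≤ ∫ x, ‖A x‖ := by
  rw [intervalIntegral.abs_intervalIntegral_eq,
    abs_of_nonneg (integral_nonneg fun _ => norm_nonneg _)]
  exact setIntegral_le_integral hA.norm (Filter.Eventually.of_forall fun _ => norm_nonneg _)

section Volterra

variable {R : Type*} [NormedRing R] [NormedSpace ℝ R] {A : ℝ → R}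

/-- The induction step of the factorial bounds for Dyson series and Volterra equations. The absolute
values cover both orders of `s` and `t`. -/
theorem norm_integral_mul_le (hA : Integrable A) {Y : ℝ → R} {C s t : ℝ} (n : ℕ)
    (hY : ∀ r ∈ uIcc s t, ‖Y r‖ ≤ C * (|∫ x in s..r, ‖A x‖| ^ n / n.factorial)) :
    ‖∫ r in s..t, A r * Y r‖ ≤ C * (|∫ x in s..t, ‖A x‖| ^ (n + 1) / (n + 1).factorial) := by
  set G : ℝ → ℝ := fun r => ∫ x in s..r, ‖A x‖ with hG
  have hGc : Continuous G := hA.norm.continuous_primitive s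
  have hi : IntervalIntegrable (fun r => ‖A r‖ * (C * (|G r| ^ n / n.factorial))) volume s t :=
    hA.norm.intervalIntegrable.mul_continuousOn
      (continuous_const.mul ((hGc.abs.pow n).div_const _)).continuousOn
  have h1 : ‖∫ r in s..t, A r * Y r‖ ≤ |∫ r in s..t, ‖A r‖ * (C * (|G r| ^ n / n.factorial))| := by
    refine intervalIntegral.norm_integral_le_abs_of_norm_le ?_ hi
    refine (ae_restrict_iff' measurableSet_uIoc).2 (Filter.Eventually.of_forall fun r hr => ?_)
    exact (norm_mul_le _ _).trans
      (mul_le_mul_of_nonneg_left (hY r (uIoc_subset_uIcc hr)) (norm_nonneg _))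
  -- `C ≥ 0` unless the bound at `t` is trivially zero
  have hC : 0 ≤ C ∨ |G t| ^ n = 0 := by
    by_contra! h
    have := (norm_nonneg _).trans (hY t right_mem_uIcc)
    have h2 : 0 < |G t| ^ n / n.factorial :=
      div_pos (lt_of_le_of_ne (by positivity) (Ne.symm h.2)) (by positivity)
    nlinarith [h.1]
  -- the sign of the primitive is constant on the interval
  have h2 : |∫ r in s..t, ‖A r‖ * (C * (|G r| ^ n / n.factorial))|
      = |C| * (|G t| ^ (n + 1) / (n + 1).factorial) := by
    have key : ∀ σ : ℝ, |σ| = 1 → (∀ r ∈ uIcc s t, |G r| = σ * G r) →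
        |∫ r in s..t, ‖A r‖ * (C * (|G r| ^ n / n.factorial))|
          = |C| * (|G t| ^ (n + 1) / (n + 1).factorial) := by
      intro σ hσ h
      have h3 : ∫ r in s..t, ‖A r‖ * (C * (|G r| ^ n / n.factorial))
          = ∫ r in s..t, (C * σ ^ n / n.factorial) * (‖A r‖ * G r ^ n) := by
        refine intervalIntegral.integral_congr fun r hr => ?_
        simp only [h r hr, mul_pow]
        ring
      have h4 : ∫ r in s..t, ‖A r‖ * G r ^ n = G t ^ (n + 1) / (n + 1) :=
        integral_mul_primitive_pow hA.norm s t n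
      rw [h3, intervalIntegral.integral_const_mul, h4]
      rw [abs_mul, abs_div, abs_mul, abs_pow, hσ, abs_div, abs_pow, Nat.factorial_succ,
        abs_of_pos (by positivity : (0 : ℝ) < n.factorial),
        abs_of_pos (by positivity : (0 : ℝ) < n + 1)]
      push_cast
      field_simp
      rw [one_pow, mul_one]
    rcases le_total s t with hst | hst
    · refine key 1 (by simp) fun r hr => ?_
      rw [uIcc_of_le hst] at hr
      rw [one_mul, abs_of_nonneg]
      exact intervalIntegral.integral_nonneg hr.1 fun _ _ => norm_nonneg _
    · refine key (-1) (by simp) fun r hr => ?_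
      rw [uIcc_of_ge hst] at hr
      rw [neg_one_mul, abs_of_nonpos]
      simp only [hG]
      rw [intervalIntegral.integral_symm]
      exact neg_nonpos.2 (intervalIntegral.integral_nonneg hr.2 fun _ _ => norm_nonneg _)
  rw [h2] at h1
  rcases hC with hC | hC
  · rwa [abs_of_nonneg hC] at h1
  · rw [pow_succ, hC] at h1 ⊢
    simpa using h1

/-- Uniqueness for linear Volterra equations: iterating the equation bounds a solution by
`C |∫ ‖A‖|ⁿ / n!` for every `n`. -/
theorem eq_zero_of_eq_integral_mul (hA : Integrable A) {X : ℝ → R} (hX : Continuous X) {s : ℝ}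
    (h : ∀ t, X t = ∫ r in s..t, A r * X r) (t : ℝ) : X t = 0 := by
  obtain ⟨C, hC⟩ := isCompact_uIcc.exists_bound_of_continuousOn (s := uIcc s t) hX.continuousOn
  have hb : ∀ n : ℕ, ∀ r ∈ uIcc s t,
      ‖X r‖ ≤ C * (|∫ x in s..r, ‖A x‖| ^ n / n.factorial) := by
    intro n
    induction n with
    | zero => simpa using hC
    | succ n ih =>
      intro r hr
      rw [h r]
      exact norm_integral_mul_le hA n fun q hq => ih q (uIcc_subset_uIcc_left hr hq)
  have hlim := (FloorSemiring.tendsto_pow_div_factorial_atTop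
    |∫ x in s..t, ‖A x‖|).const_mul C
  rw [mul_zero] at hlim
  exact norm_le_zero_iff.1 (ge_of_tendsto' hlim fun n => hb n t right_mem_uIcc)

end Volterra

/-! ### The evolution operator -/

variable {S : Type*} [NormedAddCommGroup S] [InnerProductSpace ℂ S]

/-- The generator `-(i/ℏ) H(t)` of the evolution. -/
def generator (ℏ : ℝ) (H : ℝ → S →L[ℂ] S) (t : ℝ) : S →L[ℂ] S :=
  (-Complex.I / (ℏ : ℂ)) • H t

theorem dysonTerm_succ (ℏ : ℝ) (H : ℝ → S →L[ℂ] S) (s : ℝ) (n : ℕ) (t : ℝ) :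
    dysonTerm ℏ H s (n + 1) t = ∫ r in s..t, generator ℏ H r * dysonTerm ℏ H s n r := by
  simp only [dysonTerm, generator, smul_mul_assoc]
  rw [intervalIntegral.integral_smul]

theorem dysonTerm_congr {ℏ : ℝ} {H H' : ℝ → S →L[ℂ] S} {s : ℝ} (n : ℕ) :
    ∀ {t : ℝ}, EqOn H H' (uIcc s t) → dysonTerm ℏ H s n t = dysonTerm ℏ H' s n t := by
  induction n with
  | zero => intro t _; rfl
  | succ n ih =>
    intro t h
    simp only [dysonTerm]
    congr 1
    refine intervalIntegral.integral_congr fun r hr => ?_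
    simp only [h hr, ih (h.mono (uIcc_subset_uIcc_left hr))]

theorem evolution_congr {ℏ : ℝ} {H H' : ℝ → S →L[ℂ] S} {s t : ℝ} (h : EqOn H H' (uIcc s t)) :
    evolution ℏ H t s = evolution ℏ H' t s :=
  tsum_congr fun n => dysonTerm_congr n h

/-! ### Time reversal -/

theorem antiConj_mul (Θ : S ≃ₗᵢ⋆[ℂ] S) (A B : S →L[ℂ] S) :
    antiConj Θ (A * B) = antiConj Θ A * antiConj Θ B := by
  ext x; simp [antiConj_apply]

theorem antiConj_symm_antiConj (Θ : S ≃ₗᵢ⋆[ℂ] S) (A : S →L[ℂ] S) :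
    antiConj Θ.symm (antiConj Θ A) = A := by
  ext x; simp [antiConj_apply]

theorem antiConj_smul (Θ : S ≃ₗᵢ⋆[ℂ] S) (c : ℂ) (A : S →L[ℂ] S) :
    antiConj Θ (c • A) = conj c • antiConj Θ A := by
  ext x
  simp only [antiConj_apply, smul_apply]
  exact Θ.map_smulₛₗ c _

/-- Conjugation by an anti-unitary operator, as a continuous real-linear map. -/
def antiConjL (Θ : S ≃ₗᵢ⋆[ℂ] S) : (S →L[ℂ] S) →L[ℝ] (S →L[ℂ] S) :=
  LinearMap.mkContinuous
    { toFun := antiConj Θ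
      map_add' := fun A B => by ext x; simp [antiConj_apply]
      map_smul' := fun c A => by
        have := antiConj_smul Θ (c : ℂ) A
        rwa [Complex.conj_ofReal] at this }
    1 fun A => by
      rw [one_mul]
      refine ContinuousLinearMap.opNorm_le_bound _ (norm_nonneg _) fun x => ?_
      simpa [antiConj_apply] using A.le_opNorm (Θ.symm x)

@[simp] theorem antiConjL_apply (Θ : S ≃ₗᵢ⋆[ℂ] S) (A : S →L[ℂ] S) :
    antiConjL Θ A = antiConj Θ A := rfl

section Integrable

variable {ℏ : ℝ} {H : ℝ → S →L[ℂ] S}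

theorem integrable_generator (hH : Integrable H) : Integrable (generator ℏ H) :=
  hH.smul (-Complex.I / (ℏ : ℂ))

theorem continuous_dysonTerm (hH : Integrable H) (s : ℝ) (n : ℕ) :
    Continuous (dysonTerm ℏ H s n) := by
  induction n with
  | zero => exact continuous_const
  | succ n ih =>
    have : dysonTerm ℏ H s (n + 1)
        = fun t => ∫ r in s..t, generator ℏ H r * dysonTerm ℏ H s n r :=
      funext fun t => dysonTerm_succ ℏ H s n t
    rw [this]
    exact intervalIntegral.continuous_primitive
      (fun a b => (integrable_generator hH).intervalIntegrable.mul_continuousOn ih.continuousOn) s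

theorem norm_dysonTerm_le (hH : Integrable H) (s : ℝ) (n : ℕ) (t : ℝ) :
    ‖dysonTerm ℏ H s n t‖ ≤ (∫ x, ‖generator ℏ H x‖) ^ n / n.factorial := by
  have hA := integrable_generator (ℏ := ℏ) hH
  have h : ∀ t, ‖dysonTerm ℏ H s n t‖
      ≤ 1 * (|∫ x in s..t, ‖generator ℏ H x‖| ^ n / n.factorial) := by
    induction n with
    | zero => simpa [dysonTerm] using! ContinuousLinearMap.norm_id_le (𝕜 := ℂ) (E := S)
    | succ n ih =>
      intro t
      rw [dysonTerm_succ]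
      exact norm_integral_mul_le hA n fun r _ => ih r
  refine (h t).trans ?_
  rw [one_mul]
  gcongr
  exact abs_primitive_norm_le hA s t

theorem integrable_reversedHamiltonian (Θ : S ≃ₗᵢ⋆[ℂ] S) (τ : ℝ) (hH : Integrable H) :
    Integrable (reversedHamiltonian Θ τ H) :=
  (antiConjL Θ).integrable_comp (hH.comp_sub_left τ)

variable [CompleteSpace S]

theorem summable_dysonTerm (hH : Integrable H) (s t : ℝ) :
    Summable fun n => dysonTerm ℏ H s n t :=
  Summable.of_norm_bounded (Real.summable_pow_div_factorial _)
    fun n => norm_dysonTerm_le hH s n t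

theorem continuous_evolution (hH : Integrable H) (s : ℝ) :
    Continuous fun t => evolution ℏ H t s :=
  continuous_tsum (continuous_dysonTerm hH s)
    (Real.summable_pow_div_factorial _) fun n t => norm_dysonTerm_le hH s n t

theorem intervalIntegrable_generator_mul_evolution (hH : Integrable H) (s a b : ℝ) :
    IntervalIntegrable (fun r => generator ℏ H r * evolution ℏ H r s) volume a b :=
  (integrable_generator hH).intervalIntegrable.mul_continuousOn
    (continuous_evolution hH s).continuousOn

theorem evolution_eq_integral (hH : Integrable H) (s t : ℝ) :
    evolution ℏ H t s = 1 + ∫ r in s..t, generator ℏ H r * evolution ℏ H r s := by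
  have hA := integrable_generator (ℏ := ℏ) hH
  set M := ∫ x, ‖generator ℏ H x‖
  have h := intervalIntegral.hasSum_integral_of_dominated_convergence (a := s) (b := t)
    (μ := volume) (F := fun n r => generator ℏ H r * dysonTerm ℏ H s n r)
    (f := fun r => generator ℏ H r * evolution ℏ H r s)
    (fun n r => ‖generator ℏ H r‖ * (M ^ n / n.factorial))
    (fun n => (hA.1.mul (continuous_dysonTerm hH s n).aestronglyMeasurable).restrict)
    (fun n => Filter.Eventually.of_forall fun r _ => (norm_mul_le _ _).trans
      (mul_le_mul_of_nonneg_left (norm_dysonTerm_le hH s n r) (norm_nonneg _)))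
    (Filter.Eventually.of_forall fun r _ => (Real.summable_pow_div_factorial M).mul_left _)
    (by simp only [tsum_mul_left]; exact hA.norm.intervalIntegrable.mul_const _)
    (Filter.Eventually.of_forall fun r _ => (summable_dysonTerm hH s r).hasSum.mul_left _)
  simp only [← dysonTerm_succ] at h
  rw [evolution, (summable_dysonTerm hH s t).tsum_eq_zero_add, h.tsum_eq]
  rfl

theorem evolution_sub (hH : Integrable H) (s a b : ℝ) :
    evolution ℏ H b s - evolution ℏ H a s
      = ∫ r in a..b, generator ℏ H r * evolution ℏ H r s := by
  rw [evolution_eq_integral hH s b, evolution_eq_integral hH s a, add_sub_add_left_eq_sub]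
  exact intervalIntegral.integral_interval_sub_left
    (intervalIntegrable_generator_mul_evolution hH s _ _)
    (intervalIntegrable_generator_mul_evolution hH s _ _)

@[simp] theorem evolution_self (hH : Integrable H) (s : ℝ) : evolution ℏ H s s = 1 := by
  simp [evolution_eq_integral hH s s]

/-- The composition law of the propagators. Both sides, as functions of the final time, solve the
same Volterra equation based at the intermediate time. -/
theorem evolution_mul_evolution (hH : Integrable H) (t a s : ℝ) :
    evolution ℏ H t a * evolution ℏ H a s = evolution ℏ H t s := by
  rw [← sub_eq_zero]
  refine eq_zero_of_eq_integral_mul (integrable_generator (ℏ := ℏ) hH)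
    (X := fun t => evolution ℏ H t a * evolution ℏ H a s - evolution ℏ H t s) (s := a)
    (((continuous_evolution hH a).mul continuous_const).sub (continuous_evolution hH s))
    (fun t => ?_) t
  have h1 : (∫ r in a..t, generator ℏ H r * evolution ℏ H r a) * evolution ℏ H a s
      = ∫ r in a..t, generator ℏ H r * (evolution ℏ H r a * evolution ℏ H a s) := by
    simp only [← mul_assoc]
    exact (ContinuousLinearMap.intervalIntegral_comp_comm
      ((ContinuousLinearMap.mul ℂ (S →L[ℂ] S)).flip (evolution ℏ H a s))
      (intervalIntegrable_generator_mul_evolution hH a a t)).symm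
  simp only [mul_sub]
  rw [intervalIntegral.integral_sub _ (intervalIntegrable_generator_mul_evolution hH s a t),
    ← h1, ← evolution_sub hH s a t, ← evolution_sub hH a a t, evolution_self hH, sub_mul, one_mul]
  · abel
  · exact (integrable_generator hH).intervalIntegrable.mul_continuousOn
      ((continuous_evolution hH a).mul continuous_const).continuousOn

/-- The propagator of a symmetric Hamiltonian is isometric: along a trajectory `u` the function
`‖u‖²` is absolutely continuous, and its derivative `2 Re ⟪u, -(i/ℏ) H u⟫` vanishes. -/
theorem norm_evolution_apply (hH : Integrable H) (hsymm : ∀ t, (H t).toLinearMap.IsSymmetric)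
    (s t : ℝ) (x : S) : ‖evolution ℏ H t s x‖ = ‖x‖ := by
  have hA := integrable_generator (ℏ := ℏ) hH
  let _ : InnerProductSpace ℝ S := InnerProductSpace.rclikeToReal ℂ S
  set u : ℝ → S := fun r => evolution ℏ H r s x with hu
  have hucont : Continuous u := (continuous_evolution hH s).clm_apply continuous_const
  obtain ⟨K, hK⟩ := isCompact_uIcc.exists_bound_of_continuousOn (s := uIcc s t)
    (continuous_evolution (ℏ := ℏ) hH s).continuousOn
  have hK0 : 0 ≤ K := (norm_nonneg _).trans (hK s left_mem_uIcc)
  set G : ℝ → ℝ := fun r => ∫ q in s..r, ‖generator ℏ H q‖ with hG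
  have hac : AbsolutelyContinuousOnInterval (fun r => ‖u r‖ ^ 2) s t := by
    refine absolutelyContinuousOnInterval_of_dist_le (C := 2 * (K * ‖x‖) * (K * ‖x‖))
      (hA.norm.intervalIntegrable.absolutelyContinuousOnInterval_intervalIntegral
        left_mem_uIcc) fun a ha b hb => ?_
    have h1 : ‖evolution ℏ H a s - evolution ℏ H b s‖ ≤ K * dist (G a) (G b) := by
      have hii : ∀ a b, IntervalIntegrable (fun q => ‖generator ℏ H q‖) volume a b :=
        fun a b => hA.norm.intervalIntegrable
      rw [evolution_sub hH s b a, Real.dist_eq,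
        show G a - G b = ∫ q in b..a, ‖generator ℏ H q‖ from
          intervalIntegral.integral_interval_sub_left (hii _ _) (hii _ _)]
      have h2 := norm_integral_mul_le hA (Y := fun r => evolution ℏ H r s) (C := K)
        (s := b) (t := a) 0
        (by simpa using fun r hr => hK r (uIcc_subset_uIcc hb ha hr))
      simpa using h2
    have hub : ∀ r ∈ uIcc s t, ‖u r‖ ≤ K * ‖x‖ := fun r hr =>
      (ContinuousLinearMap.le_opNorm _ _).trans
        (mul_le_mul_of_nonneg_right (hK r hr) (norm_nonneg _))
    have h3 : ‖u a - u b‖ ≤ K * dist (G a) (G b) * ‖x‖ :=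
      ((evolution ℏ H a s - evolution ℏ H b s).le_opNorm x).trans
        (mul_le_mul_of_nonneg_right h1 (norm_nonneg _))
    rw [Real.dist_eq, sq_sub_sq, abs_mul, abs_of_nonneg (by positivity)]
    calc (‖u a‖ + ‖u b‖) * |‖u a‖ - ‖u b‖|
        ≤ (K * ‖x‖ + K * ‖x‖) * (K * dist (G a) (G b) * ‖x‖) := by
          gcongr
          · exact hub a ha
          · exact hub b hb
          · exact (abs_norm_sub_norm_le _ _).trans h3
      _ = _ := by ring
  obtain ⟨C, hC⟩ := hac.const_of_ae_hasDerivAt_zero (by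
    have hloc : LocallyIntegrable fun r => generator ℏ H r * evolution ℏ H r s :=
      hA.locallyIntegrable.mul_continuous (continuous_evolution hH s)
    filter_upwards [LocallyIntegrable.ae_hasDerivAt_integral hloc] with r hr _
    have h1 : HasDerivAt (fun t => evolution ℏ H t s)
        (generator ℏ H r * evolution ℏ H r s) r := by
      have := (hr s).const_add (1 : S →L[ℂ] S)
      exact this.congr_of_eventuallyEq
        (Filter.Eventually.of_forall fun t => evolution_eq_integral hH s t)
    have h2 : HasDerivAt u (generator ℏ H r (u r)) r :=
      ((ContinuousLinearMap.apply ℂ S x).restrictScalars ℝ).hasFDerivAt.comp_hasDerivAt r h1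
    refine h2.norm_sq.congr_deriv ?_
    have h3 : (⟪u r, H r (u r)⟫_ℂ).im = 0 := by
      exact Complex.conj_eq_iff_im.1 (by
        rw [inner_conj_symm]; exact hsymm r (u r) (u r))
    have h4 : inner ℝ (u r) (generator ℏ H r (u r)) = 0 := by
      change (⟪u r, generator ℏ H r (u r)⟫_ℂ).re = 0
      have : (-Complex.I / (ℏ : ℂ)) = ((-(1 / ℏ) : ℝ) : ℂ) * Complex.I := by
        push_cast; ring
      simp [generator, inner_smul_right, this, h3]
    rw [h4, mul_zero])
  have h1 := hC s left_mem_uIcc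
  have h2 := hC t right_mem_uIcc
  have h3 : u s = x := by simp [hu, evolution_self hH]
  have h4 : ‖u t‖ ^ 2 = ‖x‖ ^ 2 := by rw [h2, ← h1, h3]
  exact (pow_left_inj₀ (norm_nonneg _) (norm_nonneg _) two_ne_zero).1 h4

/-! ### Microreversibility -/

/-- Microreversibility of the Dyson terms: undoing the time reversal turns the reversed process
into the forward process run backwards from `τ`. The conjugation of `-i` accounts for the reversed
orientation of the integral. -/
theorem antiConj_symm_dysonTerm_reversed (Θ : S ≃ₗᵢ⋆[ℂ] S) (τ : ℝ) (hH : Integrable H) (n : ℕ) :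
    ∀ t : ℝ, antiConj Θ.symm (dysonTerm ℏ (reversedHamiltonian Θ τ H) 0 n t)
      = dysonTerm ℏ H τ n (τ - t) := by
  induction n with
  | zero => intro t; ext x; simp [dysonTerm, antiConj_apply]
  | succ n ih =>
    intro t
    have hR := integrable_reversedHamiltonian Θ τ hH
    have hi : IntervalIntegrable (fun r => reversedHamiltonian Θ τ H r *
        dysonTerm ℏ (reversedHamiltonian Θ τ H) 0 n r) volume 0 t :=
      hR.intervalIntegrable.mul_continuousOn (continuous_dysonTerm hR 0 n).continuousOn
    simp only [dysonTerm]
    rw [antiConj_smul, ← antiConjL_apply, ← (antiConjL Θ.symm).intervalIntegral_comp_comm hi]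
    simp only [antiConjL_apply, antiConj_mul, ih]
    simp only [reversedHamiltonian, antiConj_symm_antiConj]
    rw [intervalIntegral.integral_comp_sub_left (fun r => H r * dysonTerm ℏ H τ n r) τ, sub_zero,
      intervalIntegral.integral_symm, smul_neg, ← neg_smul]
    congr 1
    simp [neg_div]

theorem antiConj_symm_evolution_reversed (Θ : S ≃ₗᵢ⋆[ℂ] S) (τ : ℝ) (hH : Integrable H) (t : ℝ) :
    antiConj Θ.symm (evolution ℏ (reversedHamiltonian Θ τ H) t 0) = evolution ℏ H (τ - t) τ := by
  have hR := integrable_reversedHamiltonian Θ τ hH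
  have h := (antiConjL Θ.symm).hasSum (summable_dysonTerm (ℏ := ℏ) hR 0 t).hasSum
  simp only [antiConjL_apply, antiConj_symm_dysonTerm_reversed Θ τ hH] at h
  exact h.tsum_eq.symm

end Integrable

end Dynamics

/-! ### Purifications and the visibility -/

section Purification

variable {S E : Type*} [NormedAddCommGroup S] [InnerProductSpace ℂ S]
  [NormedAddCommGroup E] [InnerProductSpace ℂ E]

theorem contract_onSystem (U : S ≃ₗᵢ[ℂ] S) {A : S →L[ℂ] S} (hA : ∀ x, A x = U x) (x : S)
    (ψ : S ⊗[ℂ] E) : contract x (onSystem A ψ) = contract (U.symm x) ψ := by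
  induction ψ with
  | zero => simp
  | tmul v w =>
    have : onSystem A (v ⊗ₜ[ℂ] w) = U v ⊗ₜ[ℂ] w := by simp [onSystem, hA]
    rw [this, contract_tmul, contract_tmul, ← U.inner_map_map (U.symm x), U.apply_symm_apply]
  | add a b ha hb => simp [ha, hb]

theorem sum_inner_contract {ι : Type*} [Fintype ι] (b : OrthonormalBasis ι ℂ S)
    (ψ φ : S ⊗[ℂ] E) : ∑ k, ⟪contract (b k) ψ, contract (b k) φ⟫_ℂ = ⟪ψ, φ⟫_ℂ := by
  induction φ with
  | zero => simp
  | tmul v w =>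
    have h : ∀ k, ⟪contract (b k) ψ, contract (b k) (v ⊗ₜ[ℂ] w)⟫_ℂ
        = ⟪ψ, (⟪b k, v⟫_ℂ • b k) ⊗ₜ[ℂ] w⟫_ℂ := by
      intro k
      rw [contract_tmul, inner_smul_right, ← inner_conj_symm (contract (b k) ψ), inner_contract]
      refine (congrArg _ (inner_conj_symm (𝕜 := ℂ) ψ (b k ⊗ₜ[ℂ] w))).trans ?_
      exact (inner_smul_right (𝕜 := ℂ) ψ (b k ⊗ₜ[ℂ] w) _).symm
    rw [Finset.sum_congr rfl fun k _ => h k]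
    refine (inner_sum (𝕜 := ℂ) Finset.univ (fun k => (⟪b k, v⟫_ℂ • b k) ⊗ₜ[ℂ] w) ψ).symm.trans ?_
    rw [← TensorProduct.sum_tmul, b.sum_repr']
  | add x y hx hy => simp [inner_add_right, Finset.sum_add_distrib, hx, hy]

theorem sum_norm_contract_sq {ι : Type*} [Fintype ι] (b : OrthonormalBasis ι ℂ S)
    (ψ : S ⊗[ℂ] E) : ∑ k, ‖contract (b k) ψ‖ ^ 2 = ‖ψ‖ ^ 2 := by
  have h := (sum_inner_contract b ψ ψ).trans (inner_self_eq_norm_sq_to_K (𝕜 := ℂ) ψ)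
  simp only [inner_self_eq_norm_sq_to_K] at h
  exact_mod_cast h

theorem abs_norm_sq_sub_norm_sq_le {F : Type*} [NormedAddCommGroup F] [InnerProductSpace ℂ F]
    (x y : F) : |‖x‖ ^ 2 - ‖y‖ ^ 2| ≤ ‖x - y‖ * ‖x + y‖ := by
  have h : (⟪x - y, x + y⟫_ℂ).re = ‖x‖ ^ 2 - ‖y‖ ^ 2 := by
    have h1 := inner_re_symm (𝕜 := ℂ) x y
    have h2 := inner_self_eq_norm_sq (𝕜 := ℂ) x
    have h3 := inner_self_eq_norm_sq (𝕜 := ℂ) y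
    simp only [RCLike.re_eq_complex_re] at h1 h2 h3
    simp only [inner_sub_left, inner_add_right, Complex.sub_re, Complex.add_re, h1, h2, h3]
    ring
  rw [← h]
  exact (Complex.abs_re_le_norm _).trans (norm_inner_le_norm _ _)

/-- If the maps `C k` resolve the norm of `F`, the weights `‖C k ψ‖²` of two unit vectors with
overlap `V` differ by at most `2 √(1 - V²)` in total. After a change of phase the overlap is `V ≥ 0`,
and then `‖ψ - φ‖ ‖ψ + φ‖ = √(2 - 2V) √(2 + 2V)`. -/
theorem sum_abs_norm_sq_sub_le {F : Type*} [NormedAddCommGroup F] [InnerProductSpace ℂ F]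
    {ι : Type*} [Fintype ι] (C : ι → F →ₗ[ℂ] E) (hC : ∀ x, ∑ k, ‖C k x‖ ^ 2 = ‖x‖ ^ 2)
    {ψ φ : F} (hψ : ‖ψ‖ = 1) (hφ : ‖φ‖ = 1) :
    ∑ k, |‖C k ψ‖ ^ 2 - ‖C k φ‖ ^ 2| ≤ 2 * √(1 - ‖⟪φ, ψ⟫_ℂ‖ ^ 2) := by
  obtain ⟨z, hz, hzV⟩ := RCLike.exists_norm_eq_mul_self (⟪φ, ψ⟫_ℂ)
  set V := ‖⟪φ, ψ⟫_ℂ‖ with hV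
  set χ := conj z • φ with hχ
  have hχ1 : ‖χ‖ = 1 := by rw [hχ, norm_smul, RCLike.norm_conj, hz, hφ, one_mul]
  have hin : ⟪χ, ψ⟫_ℂ = V := by
    rw [hχ, inner_smul_left, RCLike.conj_conj]; exact hzV.symm
  have hre : (⟪ψ, χ⟫_ℂ).re = V := by
    have := inner_re_symm (𝕜 := ℂ) ψ χ
    simp only [RCLike.re_eq_complex_re] at this
    rw [this, hin, Complex.ofReal_re]
  have hminus : ‖ψ - χ‖ ^ 2 = 2 - 2 * V := by
    rw [@norm_sub_sq ℂ, hψ, hχ1]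
    simp only [RCLike.re_eq_complex_re, hre]; ring
  have hplus : ‖ψ + χ‖ ^ 2 = 2 + 2 * V := by
    rw [@norm_add_sq ℂ, hψ, hχ1]
    simp only [RCLike.re_eq_complex_re, hre]; ring
  have hV0 : 0 ≤ V := norm_nonneg _
  have hnorm : ∀ k, ‖C k φ‖ = ‖C k χ‖ := fun k => by
    rw [hχ, map_smul, norm_smul, RCLike.norm_conj, hz, one_mul]
  calc ∑ k, |‖C k ψ‖ ^ 2 - ‖C k φ‖ ^ 2|
      ≤ ∑ k, ‖C k (ψ - χ)‖ * ‖C k (ψ + χ)‖ := by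
        refine Finset.sum_le_sum fun k _ => ?_
        rw [hnorm, map_sub, map_add]
        exact abs_norm_sq_sub_norm_sq_le _ _
    _ ≤ √(∑ k, ‖C k (ψ - χ)‖ ^ 2) * √(∑ k, ‖C k (ψ + χ)‖ ^ 2) :=
        Real.sum_mul_le_sqrt_mul_sqrt _ _ _
    _ = 2 * √(1 - V ^ 2) := by
        rw [hC, hC, hminus, hplus, ← Real.sqrt_mul' _ (by linarith),
          show (2 - 2 * V) * (2 + 2 * V) = 2 ^ 2 * (1 - V ^ 2) by ring,
          Real.sqrt_mul (by norm_num), Real.sqrt_sq (by norm_num)]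

/-- The trace-distance bound `‖ρ - σ‖₁ ≤ 2 √(1 - V²)` for the reduced states `ρ`, `σ` of two pure
states with overlap `V`, tested in an orthonormal basis. -/
theorem sum_abs_sub_le_of_overlap {ι : Type*} [Fintype ι] (b : OrthonormalBasis ι ℂ S)
    {ψ φ : S ⊗[ℂ] E} (hψ : ‖ψ‖ = 1) (hφ : ‖φ‖ = 1) :
    ∑ k, |‖contract (b k) ψ‖ ^ 2 - ‖contract (b k) φ‖ ^ 2| ≤ 2 * √(1 - ‖⟪φ, ψ⟫_ℂ‖ ^ 2) :=
  sum_abs_norm_sq_sub_le (fun k => contract (b k)) (sum_norm_contract_sq b) hψ hφ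

theorem IsPurification.onSystem {ψ : S ⊗[ℂ] E} {ρ : S →L[ℂ] S} (h : IsPurification ψ ρ)
    (U : S ≃ₗᵢ[ℂ] S) {A : S →L[ℂ] S} (hA : ∀ x, A x = U x) (x y : S) :
    ⟪x, U (ρ (U.symm y))⟫_ℂ = ⟪contract y (onSystem A ψ), contract x (onSystem A ψ)⟫_ℂ := by
  rw [contract_onSystem U hA, contract_onSystem U hA, ← h, ← U.inner_map_map (U.symm x), U.apply_symm_apply]

end Purification

/-! ### Relative entropy of transition weights

For eigenbases `u` of `ρ` and `v` of `σ` with eigenvalues `p` and `q`, the weights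
`w i j = |⟪v j, u i⟫|²` are doubly stochastic, and traces `Tr g(ρ) h(σ)` are the sums
`∑ i, ∑ j, w i j * (g (p i) * h (q j))`. This turns the entropic estimates into statements about
real numbers. -/

theorem neg_mul_log_le (x : ℝ) (hx : 0 < x) : -(x * Real.log x) ≤ (Real.exp 1)⁻¹ := by
  have he := Real.exp_pos 1
  have h := Real.log_le_sub_one_of_pos (x := (Real.exp 1 * x)⁻¹) (by positivity)
  rw [Real.log_inv, Real.log_mul he.ne' hx.ne', Real.log_exp] at h
  have h2 : x * (Real.exp 1 * x)⁻¹ = (Real.exp 1)⁻¹ := by field_simp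
  nlinarith

/-- The Fannes–Audenaert bound is dominated by its linearized form. -/
theorem fannes_le {d δ : ℝ} (hd : 2 ≤ d) (hδ : 0 < δ) (hδ1 : δ < 1) :
    δ * (Real.log (1 - δ) - Real.log (δ / (d - 1))) - Real.log (1 - δ)
      ≤ 2 * δ * Real.log d + (Real.exp 1)⁻¹ := by
  have hd1 : 0 < d - 1 := by linarith
  have ha : 0 < 1 - δ := by linarith
  rw [Real.log_div hδ.ne' hd1.ne']
  have h1 := neg_mul_log_le δ hδ
  have h2 : -((1 - δ) * Real.log (1 - δ)) ≤ δ := by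
    have h := Real.one_sub_inv_le_log_of_pos ha
    have h3 : (1 - δ) * (1 - (1 - δ)⁻¹) = -δ := by
      rw [mul_sub, mul_inv_cancel₀ ha.ne']; ring
    nlinarith
  -- `e (d - 1) ≤ 4 (d - 1) ≤ d²`
  have h3 : Real.log (d - 1) + 1 ≤ 2 * Real.log d := by
    have h4 : Real.log (Real.exp 1 * (d - 1)) ≤ Real.log (d ^ 2) := by
      refine Real.log_le_log (by positivity) ?_
      nlinarith [Real.exp_one_lt_d9, sq_nonneg (d - 2)]
    rw [Real.log_mul (Real.exp_pos 1).ne' hd1.ne', Real.log_exp, Real.log_pow] at h4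
    push_cast at h4
    linarith
  nlinarith

section Weights

variable {ι : Type*} [Fintype ι] {w : ι → ι → ℝ} {p q : ι → ℝ} {δ : ℝ}

theorem sum_sum_mul_left (hw₁ : ∀ i, ∑ j, w i j = 1) (g : ι → ℝ) :
    ∑ i, ∑ j, w i j * g i = ∑ i, g i := by
  refine Finset.sum_congr rfl fun i _ => ?_
  rw [← Finset.sum_mul, hw₁, one_mul]

theorem sum_sum_mul_right (hw₂ : ∀ j, ∑ i, w i j = 1) (g : ι → ℝ) :
    ∑ i, ∑ j, w i j * g j = ∑ j, g j := by
  rw [Finset.sum_comm]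
  exact sum_sum_mul_left (w := fun j i => w i j) hw₂ g

theorem sum_sum_sub_eq_zero (hw₁ : ∀ i, ∑ j, w i j = 1) (hw₂ : ∀ j, ∑ i, w i j = 1)
    (hp : ∑ i, p i = 1) (hq : ∑ j, q j = 1) : ∑ i, ∑ j, w i j * (p i - q j) = 0 := by
  simp only [mul_sub, Finset.sum_sub_distrib]
  rw [sum_sum_mul_left hw₁, sum_sum_mul_right hw₂, hp, hq, sub_self]

theorem le_one_of_sum_eq_one (hp0 : ∀ i, 0 < p i) (hp : ∑ i, p i = 1) (i : ι) : p i ≤ 1 :=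
  hp ▸ Finset.single_le_sum (fun j _ => (hp0 j).le) (Finset.mem_univ i)

/-- The relative entropy is at most the `χ²`-divergence. -/
theorem relativeEntropy_le_chiSq (hw : ∀ i j, 0 ≤ w i j)
    (hw₁ : ∀ i, ∑ j, w i j = 1) (hw₂ : ∀ j, ∑ i, w i j = 1)
    (hp0 : ∀ i, 0 < p i) (hq0 : ∀ j, 0 < q j) (hp : ∑ i, p i = 1) (hq : ∑ j, q j = 1)
    {α : ℝ} (hα : 0 < α) (hαq : ∀ j, α ≤ q j) :
    ∑ i, ∑ j, w i j * (p i * (Real.log (p i) - Real.log (q j)))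
      ≤ (∑ i, ∑ j, w i j * (p i - q j) ^ 2) / α := by
  have h : ∀ i j, w i j * (p i * (Real.log (p i) - Real.log (q j)))
      ≤ w i j * (p i - q j) ^ 2 / α + w i j * (p i - q j) := by
    intro i j
    have h1 : Real.log (p i) - Real.log (q j) ≤ p i / q j - 1 := by
      rw [← Real.log_div (hp0 i).ne' (hq0 j).ne']
      exact Real.log_le_sub_one_of_pos (div_pos (hp0 i) (hq0 j))
    have h2 : p i * (p i / q j - 1) = (p i - q j) ^ 2 / q j + (p i - q j) := by
      have := (hq0 j).ne'
      field_simp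
      ring
    have h3 : (p i - q j) ^ 2 / q j ≤ (p i - q j) ^ 2 / α :=
      div_le_div_of_nonneg_left (sq_nonneg _) hα (hαq j)
    have h4 : p i * (Real.log (p i) - Real.log (q j))
        ≤ (p i - q j) ^ 2 / α + (p i - q j) := by
      nlinarith [mul_le_mul_of_nonneg_left h1 (hp0 i).le]
    calc _ ≤ w i j * ((p i - q j) ^ 2 / α + (p i - q j)) :=
          mul_le_mul_of_nonneg_left h4 (hw i j)
      _ = _ := by ring
  refine (Finset.sum_le_sum fun i _ => Finset.sum_le_sum fun j _ => h i j).trans (le_of_eq ?_)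
  simp only [Finset.sum_add_distrib, ← Finset.sum_div]
  rw [sum_sum_sub_eq_zero hw₁ hw₂ hp hq, add_zero]

theorem sum_log_le (hq0 : ∀ j, 0 < q j) (hq : ∑ j, q j = 1) :
    -∑ j, q j * Real.log (q j) ≤ Real.log (Fintype.card ι) := by
  have hne : Nonempty ι := by
    by_contra h
    rw [not_nonempty_iff] at h
    simp at hq
  have hd : (0 : ℝ) < Fintype.card ι := by exact_mod_cast Fintype.card_pos
  have h : ∀ j, -(q j * Real.log (q j)) ≤
      (Fintype.card ι : ℝ)⁻¹ - q j + q j * Real.log (Fintype.card ι) := by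
    intro j
    have h1 := Real.log_le_sub_one_of_pos (x := (Fintype.card ι * q j : ℝ)⁻¹)
      (inv_pos.2 (mul_pos hd (hq0 j)))
    rw [Real.log_inv, Real.log_mul hd.ne' (hq0 j).ne'] at h1
    have h2 : q j * (Fintype.card ι * q j : ℝ)⁻¹ = (Fintype.card ι : ℝ)⁻¹ := by
      have := (hq0 j).ne'
      field_simp
    nlinarith [mul_le_mul_of_nonneg_left h1 (hq0 j).le]
  rw [← Finset.sum_neg_distrib]
  refine (Finset.sum_le_sum fun j _ => h j).trans (le_of_eq ?_)
  rw [Finset.sum_add_distrib, Finset.sum_sub_distrib, ← Finset.sum_mul, hq]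
  simp [hd.ne']

/-- Fannes' inequality `S(σ) - S(ρ) ≤ 2 δ log d + 1/e`. The two entropies are compared through the
state `ω = (1 - δ d/(d - 1)) ρ + δ/(d - 1)`, which commutes with `ρ`: Klein's inequality gives
`S(σ) ≤ -Tr σ log ω`, the spectrum of `ω` lies in `[δ/(d - 1), 1 - δ]`, and
`(1 - δ) ρ ≤ ω`. The hypothesis `htest` is the bound `Tr (ρ - σ) X ≤ 2 δ ‖X‖` for the operators `X`
diagonal in the eigenbasis of `ρ`. -/
theorem entropy_sub_le (hw : ∀ i j, 0 ≤ w i j)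
    (hw₁ : ∀ i, ∑ j, w i j = 1) (hw₂ : ∀ j, ∑ i, w i j = 1)
    (hp0 : ∀ i, 0 < p i) (hq0 : ∀ j, 0 < q j) (hp : ∑ i, p i = 1) (hq : ∑ j, q j = 1)
    (hδ : 0 < δ)
    (htest : ∀ (x : ι → ℝ) (c : ℝ), (∀ i, |x i| ≤ c) →
      ∑ i, ∑ j, w i j * (p i - q j) * x i ≤ 2 * δ * c) :
    ∑ i, p i * Real.log (p i) - ∑ j, q j * Real.log (q j)
      ≤ 2 * δ * Real.log (Fintype.card ι) + (Real.exp 1)⁻¹ := by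
  set d : ℝ := (Fintype.card ι : ℝ) with hd
  have hp1 := le_one_of_sum_eq_one hp0 hp
  -- for `d < 2` or `δ ≥ 1/2` the trivial bound `log d` on the entropy suffices
  by_cases hcase : d < 2 ∨ 1 / 2 ≤ δ
  · have h1 : ∑ i, p i * Real.log (p i) ≤ 0 :=
      Finset.sum_nonpos fun i _ =>
        mul_nonpos_of_nonneg_of_nonpos (hp0 i).le (Real.log_nonpos (hp0 i).le (hp1 i))
    have h2 := sum_log_le hq0 hq
    have h3 : Real.log d ≤ 2 * δ * Real.log d := by
      rcases hcase with h | h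
      · have h4 : Fintype.card ι < 2 := by rw [hd] at h; exact_mod_cast h
        have h5 : Real.log d = 0 := by
          rw [hd]; interval_cases Fintype.card ι <;> simp
        rw [h5, mul_zero]
      · have : 0 ≤ Real.log d := Real.log_natCast_nonneg _
        nlinarith
    have := inv_pos.2 (Real.exp_pos 1)
    linarith
  push Not at hcase
  obtain ⟨hd2, hδ2⟩ := hcase
  have hd1 : 0 < d - 1 := by linarith
  set a := 1 - δ with ha
  set c := δ / (d - 1) with hc
  have ha0 : 0 < a := by rw [ha]; linarith
  have hc0 : 0 < c := div_pos hδ hd1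
  have hcd : c * (d - 1) = δ := div_mul_cancel₀ _ hd1.ne'
  have hcδ : c ≤ δ := by nlinarith
  set ω : ι → ℝ := fun i => (1 - c * d) * p i + c with hω
  have hcoef : 0 ≤ 1 - c * d := by nlinarith
  have hωc : ∀ i, c ≤ ω i := fun i => by
    have := mul_nonneg hcoef (hp0 i).le
    simp only [hω]; linarith
  have hωa : ∀ i, ω i ≤ a := fun i => by
    have := mul_le_mul_of_nonneg_left (hp1 i) hcoef
    simp only [hω]; nlinarith
  have hωp : ∀ i, a * p i ≤ ω i := fun i => by
    have := mul_nonneg hc0.le (sub_nonneg.2 (hp1 i))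
    simp only [hω]; nlinarith
  have hω0 : ∀ i, 0 < ω i := fun i => hc0.trans_le (hωc i)
  have hωsum : ∑ i, ω i = 1 := by
    simp only [hω, Finset.sum_add_distrib, ← Finset.mul_sum, hp, Finset.sum_const,
      Finset.card_univ, nsmul_eq_mul]
    rw [← hd]; ring
  set m := (Real.log a + Real.log c) / 2 with hm
  -- subtracting the midpoint `m` of the range of `log ω` minimizes the norm of the test operator
  have hx := htest (fun i => Real.log (ω i) - m) ((Real.log a - Real.log c) / 2) fun i => by
    have h1 := Real.log_le_log hc0 (hωc i)
    have h2 := Real.log_le_log (hω0 i) (hωa i)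
    rw [abs_le]
    constructor <;> linarith
  have hpt : ∀ i j, w i j * (p i * Real.log (p i)) - w i j * (q j * Real.log (q j))
      ≤ w i j * (p i - q j) * (Real.log (ω i) - m) + m * (w i j * (p i - q j))
        + -Real.log a * (w i j * p i) + (w i j * ω i - w i j * q j) := by
    intro i j
    have h1 : Real.log (p i) ≤ Real.log (ω i) - Real.log a := by
      have := Real.log_le_log (mul_pos ha0 (hp0 i)) (hωp i)
      rw [Real.log_mul ha0.ne' (hp0 i).ne'] at this
      linarith
    have h2 : q j * (Real.log (ω i) - Real.log (q j)) ≤ ω i - q j := by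
      rw [← Real.log_div (hω0 i).ne' (hq0 j).ne']
      have h3 := Real.log_le_sub_one_of_pos (div_pos (hω0 i) (hq0 j))
      have h4 : q j * (ω i / q j - 1) = ω i - q j := by
        rw [mul_sub, mul_div_cancel₀ _ (hq0 j).ne', mul_one]
      exact h4 ▸ mul_le_mul_of_nonneg_left h3 (hq0 j).le
    have h5 : p i * Real.log (p i) - q j * Real.log (q j)
        ≤ (p i - q j) * (Real.log (ω i) - m) + m * (p i - q j) + -Real.log a * p i
          + (ω i - q j) := by
      nlinarith [mul_le_mul_of_nonneg_left h1 (hp0 i).le]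
    have := mul_le_mul_of_nonneg_left h5 (hw i j)
    linarith
  have hA : ∑ i, ∑ j, m * (w i j * (p i - q j)) = 0 := by
    simp only [← Finset.mul_sum]
    rw [sum_sum_sub_eq_zero hw₁ hw₂ hp hq, mul_zero]
  have hB : ∑ i, ∑ j, -Real.log a * (w i j * p i) = -Real.log a := by
    simp only [← Finset.mul_sum]
    rw [sum_sum_mul_left hw₁, hp, mul_one]
  have hsum := Finset.sum_le_sum fun i (_ : i ∈ Finset.univ) =>
    Finset.sum_le_sum fun j (_ : j ∈ Finset.univ) => hpt i j
  simp only [Finset.sum_add_distrib, Finset.sum_sub_distrib] at hsum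
  rw [hA, hB, sum_sum_mul_left hw₁ fun i => p i * Real.log (p i),
    sum_sum_mul_right hw₂ fun j => q j * Real.log (q j), sum_sum_mul_left hw₁ ω,
    sum_sum_mul_right hw₂ q, hωsum, hq] at hsum
  have hF := fannes_le hd2 hδ (by linarith)
  rw [← ha, ← hc] at hF
  linarith

/-- The relative entropy is at most `δ log (d²/α) + 1/e`: the term `-Tr (ρ - σ) log σ`, in which
`-log σ` ranges over an interval of length at most `-log α`, is added to the entropy difference. The hypotheses `htest` and `htest'` bound
`Tr (ρ - σ) X` by `2 δ ‖X‖` for `X` diagonal in the eigenbasis of `ρ` and of `σ`. -/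
theorem relativeEntropy_le_log (hw : ∀ i j, 0 ≤ w i j)
    (hw₁ : ∀ i, ∑ j, w i j = 1) (hw₂ : ∀ j, ∑ i, w i j = 1)
    (hp0 : ∀ i, 0 < p i) (hq0 : ∀ j, 0 < q j) (hp : ∑ i, p i = 1) (hq : ∑ j, q j = 1)
    (hδ : 0 < δ)
    (htest : ∀ (x : ι → ℝ) (c : ℝ), (∀ i, |x i| ≤ c) →
      ∑ i, ∑ j, w i j * (p i - q j) * x i ≤ 2 * δ * c)
    (htest' : ∀ (x : ι → ℝ) (c : ℝ), (∀ i, |x i| ≤ c) →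
      ∑ i, ∑ j, w i j * (p i - q j) * x j ≤ 2 * δ * c)
    {α : ℝ} (hα : 0 < α) (hαq : ∀ j, α ≤ q j) :
    ∑ i, ∑ j, w i j * (p i * (Real.log (p i) - Real.log (q j)))
      ≤ δ * Real.log ((Fintype.card ι : ℝ) ^ 2 / α) + (Real.exp 1)⁻¹ := by
  have hne : Nonempty ι := by
    by_contra h
    rw [not_nonempty_iff] at h
    simp at hp
  have hd : (0 : ℝ) < Fintype.card ι := by exact_mod_cast Fintype.card_pos
  have hS := entropy_sub_le hw hw₁ hw₂ hp0 hq0 hp hq hδ htest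
  -- `-log σ` shifted by the midpoint of its range `[0, -log α]`
  have hx := htest' (fun j => -Real.log (q j) + Real.log α / 2) (-Real.log α / 2) fun j => by
    have h1 := Real.log_le_log hα (hαq j)
    have h2 := Real.log_nonpos (hq0 j).le (le_one_of_sum_eq_one hq0 hq j)
    rw [abs_le]
    constructor <;> linarith
  have hA : ∑ i, ∑ j, Real.log α / 2 * (w i j * (p i - q j)) = 0 := by
    simp only [← Finset.mul_sum]
    rw [sum_sum_sub_eq_zero hw₁ hw₂ hp hq, mul_zero]
  have hpt : ∀ i j, w i j * (p i * (Real.log (p i) - Real.log (q j)))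
      = w i j * (p i * Real.log (p i)) - w i j * (q j * Real.log (q j))
        + w i j * (p i - q j) * (-Real.log (q j) + Real.log α / 2)
        - Real.log α / 2 * (w i j * (p i - q j)) := fun i j => by ring
  simp only [hpt, Finset.sum_add_distrib, Finset.sum_sub_distrib]
  rw [hA, sum_sum_mul_left hw₁ fun i => p i * Real.log (p i),
    sum_sum_mul_right hw₂ fun j => q j * Real.log (q j),
    Real.log_div (by positivity) hα.ne', Real.log_pow]
  push_cast
  linarith

end Weights

/-! ### Relative entropy of two purified states -/

section RelativeEntropy

variable {S E : Type*} [NormedAddCommGroup S] [InnerProductSpace ℂ S]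
  [NormedAddCommGroup E] [InnerProductSpace ℂ E] {ι : Type*} [Fintype ι]

theorem inner_apply_of_eigenbasis (u : OrthonormalBasis ι ℂ S) {ρ : S →L[ℂ] S} {p : ι → ℝ}
    (hρ : ∀ i, ρ (u i) = (p i : ℂ) • u i) (x : S) :
    ⟪x, ρ x⟫_ℂ = ((∑ i, ‖⟪x, u i⟫_ℂ‖ ^ 2 * p i : ℝ) : ℂ) := by
  conv_lhs => rw [← u.sum_repr' x, map_sum, u.sum_repr' x, inner_sum]
  push_cast
  refine Finset.sum_congr rfl fun i _ => ?_
  rw [map_smul, hρ, inner_smul_right, inner_smul_right, ← inner_conj_symm (u i) x, mul_left_comm,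
    RCLike.conj_mul, mul_comm]
  rfl

theorem IsPurification.norm_contract_sq {ψ : S ⊗[ℂ] E} {ρ : S →L[ℂ] S} (h : IsPurification ψ ρ)
    (u : OrthonormalBasis ι ℂ S) {p : ι → ℝ} (hρ : ∀ i, ρ (u i) = (p i : ℂ) • u i) (x : S) :
    ‖contract x ψ‖ ^ 2 = ∑ i, ‖⟪x, u i⟫_ℂ‖ ^ 2 * p i := by
  rw [← inner_self_eq_norm_sq (𝕜 := ℂ), ← h x x, inner_apply_of_eigenbasis u hρ]
  exact Complex.ofReal_re _

theorem IsPurification.isSymmetric {ψ : S ⊗[ℂ] E} {ρ : S →L[ℂ] S} (h : IsPurification ψ ρ) :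
    ρ.toLinearMap.IsSymmetric := fun x y => by
  have h1 := h x y
  have h2 := h y x
  change ⟪ρ x, y⟫_ℂ = ⟪x, ρ y⟫_ℂ
  rw [h1, ← inner_conj_symm, h2, inner_conj_symm]

theorem norm_inner_sq_self (u : OrthonormalBasis ι ℂ S) (p : ι → ℝ) (i : ι) :
    ∑ j, ‖⟪u i, u j⟫_ℂ‖ ^ 2 * p j = p i := by
  classical
  simp [orthonormal_iff_ite.1 u.orthonormal, apply_ite, ite_pow]

theorem IsPurification.norm_eq_one {ψ : S ⊗[ℂ] E} {ρ : S →L[ℂ] S} (h : IsPurification ψ ρ)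
    (u : OrthonormalBasis ι ℂ S) {p : ι → ℝ} (hρ : ∀ i, ρ (u i) = (p i : ℂ) • u i)
    (hp : ∑ i, p i = 1) : ‖ψ‖ = 1 := by
  have h1 := sum_norm_contract_sq u ψ
  simp only [h.norm_contract_sq u hρ, norm_inner_sq_self, hp] at h1
  nlinarith [norm_nonneg ψ]

theorem sum_mul_le_of_abs_le {x y : ι → ℝ} {c B : ℝ} (hB : ∑ k, |y k| ≤ B)
    (hx : ∀ k, |x k| ≤ c) (hc : 0 ≤ c) : ∑ k, y k * x k ≤ B * c := by
  calc ∑ k, y k * x k ≤ ∑ k, |y k| * c := Finset.sum_le_sum fun k _ => by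
        refine (le_abs_self _).trans ?_
        rw [abs_mul]
        exact mul_le_mul_of_nonneg_left (hx k) (abs_nonneg _)
    _ = (∑ k, |y k|) * c := by rw [Finset.sum_mul]
    _ ≤ B * c := mul_le_mul_of_nonneg_right hB hc

/-- The squared Hilbert–Schmidt distance of the two reduced states, computed in their eigenbases,
is at most `4 (1 - V²)`: in the eigenbasis of `ρ - σ` it is dominated by the squared trace norm. -/
theorem sum_sum_sq_sub_le [FiniteDimensional ℂ S] (u v : OrthonormalBasis ι ℂ S)
    {ρ σ : S →L[ℂ] S} {p q : ι → ℝ}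
    (hρ : ∀ i, ρ (u i) = (p i : ℂ) • u i) (hσ : ∀ j, σ (v j) = (q j : ℂ) • v j)
    {ψ φ : S ⊗[ℂ] E} (hψ : IsPurification ψ ρ) (hφ : IsPurification φ σ)
    (hp : ∑ i, p i = 1) (hq : ∑ j, q j = 1) :
    ∑ i, ∑ j, ‖⟪v j, u i⟫_ℂ‖ ^ 2 * (p i - q j) ^ 2 ≤ (2 * √(1 - ‖⟪φ, ψ⟫_ℂ‖ ^ 2)) ^ 2 := by
  have hD : (ρ - σ).toLinearMap.IsSymmetric := hψ.isSymmetric.sub hφ.isSymmetric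
  set b := hD.eigenvectorBasis rfl with hb
  set x := hD.eigenvalues rfl with hx
  have hbx : ∀ k, (ρ - σ) (b k) = (x k : ℂ) • b k := fun k => hD.apply_eigenvectorBasis rfl k
  have hxk : ∀ k, x k = ‖contract (b k) ψ‖ ^ 2 - ‖contract (b k) φ‖ ^ 2 := by
    intro k
    have h1 : ⟪b k, (ρ - σ) (b k)⟫_ℂ = x k := by
      rw [hbx, inner_smul_right, inner_self_eq_norm_sq_to_K, b.orthonormal.1]
      simp
    rw [← inner_self_eq_norm_sq (𝕜 := ℂ), ← inner_self_eq_norm_sq (𝕜 := ℂ), ← hψ, ← hφ, ← map_sub,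
      ← inner_sub_right, ← sub_apply, h1]
    exact (Complex.ofReal_re _).symm
  have h1 : ∀ i j, ‖⟪v j, u i⟫_ℂ‖ ^ 2 * (p i - q j) ^ 2 = ‖⟪v j, (ρ - σ) (u i)⟫_ℂ‖ ^ 2 := by
    intro i j
    have h2 : ⟪v j, σ (u i)⟫_ℂ = q j * ⟪v j, u i⟫_ℂ := by
      have : ⟪v j, σ (u i)⟫_ℂ = ⟪σ (v j), u i⟫_ℂ := (hφ.isSymmetric (v j) (u i)).symm
      rw [this, hσ, inner_smul_left, Complex.conj_ofReal]
    rw [sub_apply, inner_sub_right, h2, hρ, inner_smul_right, ← sub_mul,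
      ← Complex.ofReal_sub, norm_mul, Complex.norm_real, mul_pow, Real.norm_eq_abs, sq_abs,
      mul_comm]
  have h2 : ∀ i k, ‖⟪b k, (ρ - σ) (u i)⟫_ℂ‖ ^ 2 = x k ^ 2 * ‖⟪b k, u i⟫_ℂ‖ ^ 2 := by
    intro i k
    have : ⟪b k, (ρ - σ) (u i)⟫_ℂ = ⟪(ρ - σ) (b k), u i⟫_ℂ := (hD (b k) (u i)).symm
    rw [this, hbx, inner_smul_left, Complex.conj_ofReal, norm_mul, Complex.norm_real, mul_pow,
      Real.norm_eq_abs, sq_abs]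
  have h3 : ∑ i, ∑ j, ‖⟪v j, u i⟫_ℂ‖ ^ 2 * (p i - q j) ^ 2 = ∑ k, x k ^ 2 := by
    simp only [h1, v.sum_sq_norm_inner_right]
    simp only [← b.sum_sq_norm_inner_right, h2]
    rw [Finset.sum_comm]
    simp only [← Finset.mul_sum, u.sum_sq_norm_inner_left, b.orthonormal.1, one_pow, mul_one]
  have h4 : ∑ k, |x k| ≤ 2 * √(1 - ‖⟪φ, ψ⟫_ℂ‖ ^ 2) := by
    simp only [hxk]
    exact sum_abs_sub_le_of_overlap b (hψ.norm_eq_one u hρ hp) (hφ.norm_eq_one v hσ hq)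
  rw [h3]
  calc ∑ k, x k ^ 2 = ∑ k, |x k| ^ 2 := by simp only [sq_abs]
    _ ≤ (∑ k, |x k|) ^ 2 := Finset.sum_sq_le_sq_sum_of_nonneg fun k _ => abs_nonneg _
    _ ≤ _ := pow_le_pow_left₀ (Finset.sum_nonneg fun k _ => abs_nonneg _) h4 2

/-- Both bounds for the relative entropy of two states in terms of the overlap of purifications. -/
theorem relativeEntropy_le_of_overlap [FiniteDimensional ℂ S] (u v : OrthonormalBasis ι ℂ S)
    {ρ σ : S →L[ℂ] S} {p q : ι → ℝ}
    (hρ : ∀ i, ρ (u i) = (p i : ℂ) • u i) (hσ : ∀ j, σ (v j) = (q j : ℂ) • v j)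
    {ψ φ : S ⊗[ℂ] E} (hψ : IsPurification ψ ρ) (hφ : IsPurification φ σ)
    (hp0 : ∀ i, 0 < p i) (hq0 : ∀ j, 0 < q j) (hp : ∑ i, p i = 1) (hq : ∑ j, q j = 1)
    {α : ℝ} (hα : 0 < α) (hαq : ∀ j, α ≤ q j) :
    ∑ i, ∑ j, ‖⟪v j, u i⟫_ℂ‖ ^ 2 * (p i * (Real.log (p i) - Real.log (q j)))
        ≤ 4 * (1 - ‖⟪φ, ψ⟫_ℂ‖ ^ 2) / α ∧
      ∑ i, ∑ j, ‖⟪v j, u i⟫_ℂ‖ ^ 2 * (p i * (Real.log (p i) - Real.log (q j)))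
        ≤ √(1 - ‖⟪φ, ψ⟫_ℂ‖ ^ 2) * Real.log ((Fintype.card ι : ℝ) ^ 2 / α)
          + (Real.exp 1)⁻¹ := by
  have hψ1 := hψ.norm_eq_one u hρ hp
  have hφ1 := hφ.norm_eq_one v hσ hq
  have hV : ‖⟪φ, ψ⟫_ℂ‖ ^ 2 ≤ 1 := by
    have h := norm_inner_le_norm (𝕜 := ℂ) φ ψ
    rw [hφ1, hψ1, one_mul] at h
    exact pow_le_one₀ (norm_nonneg _) h
  set δ := √(1 - ‖⟪φ, ψ⟫_ℂ‖ ^ 2) with hδ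
  have hδsq : δ ^ 2 = 1 - ‖⟪φ, ψ⟫_ℂ‖ ^ 2 := Real.sq_sqrt (sub_nonneg.2 hV)
  have hw : ∀ i j, 0 ≤ ‖⟪v j, u i⟫_ℂ‖ ^ 2 := fun i j => sq_nonneg _
  have hw₁ : ∀ i, ∑ j, ‖⟪v j, u i⟫_ℂ‖ ^ 2 = 1 := fun i => by
    rw [v.sum_sq_norm_inner_right, u.orthonormal.1, one_pow]
  have hw₂ : ∀ j, ∑ i, ‖⟪v j, u i⟫_ℂ‖ ^ 2 = 1 := fun j => by
    rw [u.sum_sq_norm_inner_left, v.orthonormal.1, one_pow]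
  have hne : Nonempty ι := by
    by_contra h
    rw [not_nonempty_iff] at h
    simp at hp
  have hc0 : ∀ {x : ι → ℝ} {c : ℝ}, (∀ i, |x i| ≤ c) → 0 ≤ c := fun h =>
    (abs_nonneg _).trans (h hne.some)
  have hB : ∀ b : OrthonormalBasis ι ℂ S,
      ∑ k, |‖contract (b k) ψ‖ ^ 2 - ‖contract (b k) φ‖ ^ 2| ≤ 2 * δ :=
    fun b => sum_abs_sub_le_of_overlap b hψ1 hφ1
  have htest : ∀ (x : ι → ℝ) (c : ℝ), (∀ i, |x i| ≤ c) →
      ∑ i, ∑ j, ‖⟪v j, u i⟫_ℂ‖ ^ 2 * (p i - q j) * x i ≤ 2 * δ * c := by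
    intro x c hx
    refine le_of_eq_of_le (Finset.sum_congr rfl fun i _ => ?_)
      (sum_mul_le_of_abs_le (hB u) hx (hc0 hx))
    rw [hψ.norm_contract_sq u hρ, hφ.norm_contract_sq v hσ, norm_inner_sq_self, ← Finset.sum_mul]
    congr 1
    simp only [mul_sub, Finset.sum_sub_distrib, ← Finset.sum_mul, hw₁, one_mul,
      norm_inner_symm (u i)]
  have htest' : ∀ (x : ι → ℝ) (c : ℝ), (∀ i, |x i| ≤ c) →
      ∑ i, ∑ j, ‖⟪v j, u i⟫_ℂ‖ ^ 2 * (p i - q j) * x j ≤ 2 * δ * c := by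
    intro x c hx
    rw [Finset.sum_comm]
    refine le_of_eq_of_le (Finset.sum_congr rfl fun j _ => ?_)
      (sum_mul_le_of_abs_le (hB v) hx (hc0 hx))
    rw [hψ.norm_contract_sq u hρ, hφ.norm_contract_sq v hσ, norm_inner_sq_self, ← Finset.sum_mul]
    congr 1
    simp only [mul_sub, Finset.sum_sub_distrib, ← Finset.sum_mul, hw₂, one_mul]
  have h1 : ∑ i, ∑ j, ‖⟪v j, u i⟫_ℂ‖ ^ 2 * (p i * (Real.log (p i) - Real.log (q j)))
        ≤ 4 * δ ^ 2 / α := by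
    refine (relativeEntropy_le_chiSq hw hw₁ hw₂ hp0 hq0 hp hq hα hαq).trans ?_
    have h2 := sum_sum_sq_sub_le u v hρ hσ hψ hφ hp hq
    rw [← hδ, mul_pow] at h2
    gcongr
    linarith
  refine ⟨hδsq ▸ h1, ?_⟩
  have hδ0 : 0 ≤ δ := Real.sqrt_nonneg _
  clear_value δ
  -- for `δ = 0` the first bound already gives a nonpositive relative entropy
  rcases hδ0.eq_or_lt with h0 | h0
  · rw [← h0] at h1 ⊢
    have := inv_pos.2 (Real.exp_pos 1)
    simp only [zero_mul, zero_add]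
    refine h1.trans ?_
    simpa using this.le
  · exact relativeEntropy_le_log hw hw₁ hw₂ hp0 hq0 hp hq h0 htest htest' hα hαq

end RelativeEntropy

/-! ### Thermal states and the work distribution -/

section Thermal

open MeasureTheory

variable {S : Type*} [NormedAddCommGroup S] [InnerProductSpace ℂ S]

theorem exp_apply_of_apply_eq_smul [CompleteSpace S] {A : S →L[ℂ] S} {x : S} {c : ℂ}
    (h : A x = c • x) : NormedSpace.exp A x = Complex.exp c • x := by
  have hpow : ∀ n : ℕ, (A ^ n) x = c ^ n • x := by
    intro n
    induction n with
    | zero => simp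
    | succ n ih => rw [pow_succ, mul_apply_eq_comp, h, map_smul, ih, smul_smul, pow_succ']
  have h1 := (ContinuousLinearMap.apply ℂ S x).hasSum (NormedSpace.exp_series_hasSum_exp' (𝕂 := ℂ) A)
  have h2 := (NormedSpace.exp_series_hasSum_exp' (𝕂 := ℂ) c).smul_const x
  rw [← Complex.exp_eq_exp_ℂ] at h2
  refine h1.unique ?_
  convert! h2 using 2 with n
  simp [hpow, smul_smul]

variable {ι : Type*} [Fintype ι] {β : ℝ} {H : S →L[ℂ] S} (e : OrthonormalBasis ι ℂ S)
  {ε : ι → ℝ}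

theorem thermalState_apply [CompleteSpace S] {x : S} {E : ℝ} (h : H x = (E : ℂ) • x) :
    thermalState β H x = (Real.exp (-β * (E - freeEnergy β H)) : ℂ) • x := by
  rw [thermalState, exp_apply_of_apply_eq_smul (c := (-β : ℂ) * (E - freeEnergy β H))]
  · push_cast; rfl
  · rw [smul_apply, sub_apply, smul_apply, h, one_apply_eq_self, ← sub_smul, smul_smul]

theorem freeEnergy_eq [CompleteSpace S] (he : ∀ n, H (e n) = (ε n : ℂ) • e n) :
    freeEnergy β H = -β⁻¹ * Real.log (∑ n, Real.exp (-β * ε n)) := by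
  rw [freeEnergy, LinearMap.trace_eq_sum_inner _ e]
  congr 2
  have h : ∀ n, ⟪e n, (NormedSpace.exp ((-β : ℂ) • H) : S →L[ℂ] S) (e n)⟫_ℂ
      = ((Real.exp (-β * ε n) : ℝ) : ℂ) := by
    intro n
    rw [exp_apply_of_apply_eq_smul (c := (-β : ℂ) * ε n) (by rw [smul_apply, he, smul_smul]),
      inner_smul_right, inner_self_eq_norm_sq_to_K, e.orthonormal.1]
    simp
  simp only [ContinuousLinearMap.coe_coe, h]
  rw [← Complex.ofReal_sum, Complex.ofReal_re]

theorem sum_exp_sub_freeEnergy [CompleteSpace S] [Nonempty ι] (hβ : β ≠ 0)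
    (he : ∀ n, H (e n) = (ε n : ℂ) • e n) :
    ∑ n, Real.exp (-β * (ε n - freeEnergy β H)) = 1 := by
  have hZ : 0 < ∑ n, Real.exp (-β * ε n) :=
    Finset.sum_pos (fun _ _ => Real.exp_pos _) Finset.univ_nonempty
  have h : β * freeEnergy β H = -Real.log (∑ n, Real.exp (-β * ε n)) := by
    rw [freeEnergy_eq e he]; field_simp
  have h2 : ∀ n, Real.exp (-β * (ε n - freeEnergy β H))
      = Real.exp (-β * ε n) * (∑ n, Real.exp (-β * ε n))⁻¹ := by
    intro n
    rw [show -β * (ε n - freeEnergy β H) = -β * ε n + β * freeEnergy β H by ring, Real.exp_add, h,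
      Real.exp_neg, Real.exp_log hZ]
  simp only [h2]
  rw [← Finset.sum_mul, mul_inv_cancel₀ hZ.ne']

theorem avgDissipativeWork_workDistribution (F₀ ΔF : ℝ) (f : OrthonormalBasis ι ℂ S)
    (ε' : ι → ℝ) (U : S →L[ℂ] S) :
    avgDissipativeWork (workDistribution β F₀ e f ε ε' U) ΔF
      = ∑ n, ∑ m, Real.exp (-β * (ε n - F₀)) * ‖⟪f m, U (e n)⟫_ℂ‖ ^ 2 *
          (ε' m - ε n - ΔF) := by
  have hi : ∀ n m, Integrable (fun W : ℝ => W - ΔF)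
      (ENNReal.ofReal (Real.exp (-β * (ε n - F₀)) * ‖⟪f m, U (e n)⟫_ℂ‖ ^ 2) •
        Measure.dirac (ε' m - ε n)) := fun n m =>
    (integrable_dirac (by simp)).smul_measure ENNReal.ofReal_ne_top
  rw [avgDissipativeWork, workDistribution,
    integral_finsetSum_measure fun n _ => integrable_finsetSum_measure.2 fun m _ => hi n m]
  refine Finset.sum_congr rfl fun n _ => ?_
  rw [integral_finsetSum_measure fun m _ => hi n m]
  refine Finset.sum_congr rfl fun m _ => ?_
  rw [integral_smul_measure, integral_dirac, ENNReal.toReal_ofReal (by positivity), smul_eq_mul]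

/-- A symmetric operator has no eigenvalues besides those of an orthonormal eigenbasis. -/
theorem exists_eq_of_hasEigenvalue {ρ : S →L[ℂ] S} (hs : ρ.toLinearMap.IsSymmetric) {q : ι → ℝ}
    (f : OrthonormalBasis ι ℂ S) (hρ : ∀ j, ρ (f j) = (q j : ℂ) • f j) {a : ℝ}
    (ha : Module.End.HasEigenvalue ρ.toLinearMap (a : ℂ)) : ∃ j, q j = a := by
  obtain ⟨x, hx⟩ := ha.exists_hasEigenvector
  by_contra! hne
  refine hx.2 ?_
  have h1 : ρ x = (a : ℂ) • x := hx.apply_eq_smul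
  have h2 : ∀ j, ⟪f j, x⟫_ℂ = 0 := by
    intro j
    have h3 : ⟪ρ (f j), x⟫_ℂ = ⟪f j, ρ x⟫_ℂ := hs (f j) x
    rw [hρ, h1, inner_smul_left, inner_smul_right, Complex.conj_ofReal, ← sub_eq_zero,
      ← sub_mul, ← Complex.ofReal_sub] at h3
    exact (mul_eq_zero.1 h3).resolve_left (Complex.ofReal_ne_zero.2 (sub_ne_zero.2 (hne j)))
  rw [← f.sum_repr' x]
  simp [h2]

theorem hasEigenvalue_of_eigenbasis {ρ : S →L[ℂ] S} {q : ι → ℝ} (f : OrthonormalBasis ι ℂ S)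
    (hρ : ∀ j, ρ (f j) = (q j : ℂ) • f j) (j : ι) :
    Module.End.HasEigenvalue ρ.toLinearMap (q j : ℂ) :=
  Module.End.hasEigenvalue_of_hasEigenvector
    ⟨Module.End.mem_eigenspace_iff.2 (hρ j), f.orthonormal.ne_zero j⟩

end Thermal

/-! ### Isometric propagators as unitaries -/

section Unitary

variable {S : Type*} [NormedAddCommGroup S] [InnerProductSpace ℂ S] [FiniteDimensional ℂ S]

/-- An isometric operator on a finite-dimensional space as a unitary. -/
def unitaryOfNormEq (A : S →L[ℂ] S) (hA : ∀ x, ‖A x‖ = ‖x‖) : S ≃ₗᵢ[ℂ] S :=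
  LinearIsometry.toLinearIsometryEquiv ⟨A.toLinearMap, hA⟩ rfl

end Unitary

end WorkInterferometry

end

theorem mainTheorem2
    {S E : Type*} [NormedAddCommGroup S] [InnerProductSpace ℂ S] [FiniteDimensional ℂ S]
    [NormedAddCommGroup E] [InnerProductSpace ℂ E]
    -- Planck constant, Boltzmann constant, temperature, duration
    (ℏ kB T τ : ℝ) (hℏ : 0 < ℏ) (hkB : 0 < kB) (hT : 0 < T) (hτ : 0 ≤ τ)
    -- inverse temperature
    (β : ℝ) (hβ : β = 1 / (kB * T))
    -- driving Hamiltonian and time-reversal operator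
    (H : ℝ → S →L[ℂ] S)
    (hH : ∀ t ∈ Set.Icc 0 τ, (H t).toLinearMap.IsSymmetric)
    (hHint : IntervalIntegrable H MeasureTheory.volume 0 τ)
    (Θ : S ≃ₗᵢ⋆[ℂ] S)
    -- eigenbases and eigenvalues of the initial and final Hamiltonians
    (e f : OrthonormalBasis (Fin (Module.finrank ℂ S)) ℂ S)
    (ε ε' : Fin (Module.finrank ℂ S) → ℝ)
    (he : ∀ n, H 0 (e n) = (ε n : ℂ) • e n)
    (hf : ∀ m, H τ (f m) = (ε' m : ℂ) • f m)
    -- purifications of the initial and final thermal states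
    (ψ ψ' : S ⊗[ℂ] E)
    (hψ : WorkInterferometry.IsPurification ψ (WorkInterferometry.thermalState β (H 0)))
    (hψ' : WorkInterferometry.IsPurification ψ' (WorkInterferometry.thermalState β (H τ)))
    -- average dissipative work
    (Wdiss : ℝ)
    (hWdiss : Wdiss = WorkInterferometry.avgDissipativeWork
      (WorkInterferometry.workDistribution β (WorkInterferometry.freeEnergy β (H 0)) e f ε ε'
        (WorkInterferometry.evolution ℏ H τ 0))
      (WorkInterferometry.freeEnergy β (H τ) - WorkInterferometry.freeEnergy β (H 0)))
    -- visibility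
    (V : ℝ)
    (hV : V = WorkInterferometry.visibility (WorkInterferometry.pathDensity
      (WorkInterferometry.jointState (WorkInterferometry.pathZero ℏ τ H ψ)
        (WorkInterferometry.pathOne ℏ τ Θ H ψ'))))
    -- smallest eigenvalue of the final thermal state
    (α : ℝ)
    (hα : IsLeast {a : ℝ | Module.End.HasEigenvalue
      (WorkInterferometry.thermalState β (H τ)).toLinearMap (a : ℂ)} α) :
    Wdiss ≤ kB * T * (4 * (1 - V ^ 2) / α) ∧
      Wdiss ≤ kB * T *
        (√(1 - V ^ 2) * Real.log ((Module.finrank ℂ S : ℝ) ^ 2 / α) + (Real.exp 1)⁻¹) := by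
  have hfc : CompleteSpace S := FiniteDimensional.complete ℂ S
  have hβ0 : 0 < β := by rw [hβ]; positivity
  have hβinv : kB * T = β⁻¹ := by rw [hβ, one_div, inv_inv]
  -- the Hamiltonian extended by zero, which is integrable and symmetric at all times
  set K : ℝ → S →L[ℂ] S := Set.indicator (Set.Icc 0 τ) H with hK
  have hKint : MeasureTheory.Integrable K :=
    (MeasureTheory.integrable_indicator_iff measurableSet_Icc).2
      ((intervalIntegrable_iff_integrableOn_Icc_of_le hτ).1 hHint)
  have hKsymm : ∀ t, (K t).toLinearMap.IsSymmetric := by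
    intro t
    by_cases ht : t ∈ Set.Icc 0 τ
    · rw [hK, Set.indicator_of_mem ht]; exact hH t ht
    · rw [hK, Set.indicator_of_notMem ht]; intro x y; simp
  have hKH : ∀ t ∈ Set.Icc 0 τ, H t = K t := fun t ht => (Set.indicator_of_mem ht H).symm
  have hU : WorkInterferometry.evolution ℏ H τ 0 = WorkInterferometry.evolution ℏ K τ 0 :=
    WorkInterferometry.evolution_congr fun t ht => hKH t (by rwa [Set.uIcc_of_le hτ] at ht)
  have hU₀ : WorkInterferometry.evolution ℏ H (τ / 2) 0
      = WorkInterferometry.evolution ℏ K (τ / 2) 0 :=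
    WorkInterferometry.evolution_congr fun t ht => hKH t (by
      rw [Set.uIcc_of_le (by linarith)] at ht
      exact ⟨ht.1, by linarith [ht.2]⟩)
  have hU₁ : WorkInterferometry.antiConj Θ.symm (WorkInterferometry.evolution ℏ
      (WorkInterferometry.reversedHamiltonian Θ τ H) (τ / 2) 0)
      = WorkInterferometry.evolution ℏ K (τ / 2) τ := by
    rw [WorkInterferometry.evolution_congr
      (H' := WorkInterferometry.reversedHamiltonian Θ τ K) fun t ht => ?_,
      WorkInterferometry.antiConj_symm_evolution_reversed Θ τ hKint, sub_half]
    rw [Set.uIcc_of_le (by linarith)] at ht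
    rw [WorkInterferometry.reversedHamiltonian, WorkInterferometry.reversedHamiltonian,
      hKH (τ - t) ⟨by linarith [ht.2], by linarith [ht.1]⟩]
  -- the two half-way propagators as unitaries
  set U₀ := WorkInterferometry.unitaryOfNormEq (WorkInterferometry.evolution ℏ K (τ / 2) 0)
    (WorkInterferometry.norm_evolution_apply hKint hKsymm 0 (τ / 2)) with hU₀def
  set U₁ := WorkInterferometry.unitaryOfNormEq (WorkInterferometry.evolution ℏ K (τ / 2) τ)
    (WorkInterferometry.norm_evolution_apply hKint hKsymm τ (τ / 2)) with hU₁def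
  set p : Fin (Module.finrank ℂ S) → ℝ := fun n =>
    Real.exp (-β * (ε n - WorkInterferometry.freeEnergy β (H 0))) with hp
  set q : Fin (Module.finrank ℂ S) → ℝ := fun m =>
    Real.exp (-β * (ε' m - WorkInterferometry.freeEnergy β (H τ))) with hq
  have hρe : ∀ n, WorkInterferometry.thermalState β (H 0) (e n) = (p n : ℂ) • e n :=
    fun n => WorkInterferometry.thermalState_apply (he n)
  have hσf : ∀ m, WorkInterferometry.thermalState β (H τ) (f m) = (q m : ℂ) • f m :=
    fun m => WorkInterferometry.thermalState_apply (hf m)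
  obtain ⟨j₀, hj₀⟩ := WorkInterferometry.exists_eq_of_hasEigenvalue hψ'.isSymmetric f hσf hα.1
  have hne : Nonempty (Fin (Module.finrank ℂ S)) := ⟨j₀⟩
  have hα0 : 0 < α := hj₀ ▸ Real.exp_pos _
  have hαq : ∀ j, α ≤ q j := fun j =>
    hα.2 (WorkInterferometry.hasEigenvalue_of_eigenbasis f hσf j)
  have hφ₀ : WorkInterferometry.IsPurification (WorkInterferometry.pathZero ℏ τ H ψ)
      ((U₀.toContinuousLinearEquiv : S →L[ℂ] S).comp
        ((WorkInterferometry.thermalState β (H 0)).comp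
          (U₀.symm.toContinuousLinearEquiv : S →L[ℂ] S))) := by
    rw [WorkInterferometry.pathZero, hU₀]
    exact hψ.onSystem U₀ fun x => rfl
  have hφ₁ : WorkInterferometry.IsPurification (WorkInterferometry.pathOne ℏ τ Θ H ψ')
      ((U₁.toContinuousLinearEquiv : S →L[ℂ] S).comp
        ((WorkInterferometry.thermalState β (H τ)).comp
          (U₁.symm.toContinuousLinearEquiv : S →L[ℂ] S))) := by
    rw [WorkInterferometry.pathOne, hU₁]
    exact hψ'.onSystem U₁ fun x => rfl
  have hmain := WorkInterferometry.relativeEntropy_le_of_overlap (e.map U₀) (f.map U₁)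
    (p := p) (q := q) (fun i => by simp [hρe]) (fun j => by simp [hσf]) hφ₀ hφ₁
    (fun _ => Real.exp_pos _) (fun _ => Real.exp_pos _)
    (WorkInterferometry.sum_exp_sub_freeEnergy e hβ0.ne' he)
    (WorkInterferometry.sum_exp_sub_freeEnergy f hβ0.ne' hf) hα0 hαq
  -- `U₁ U(τ, 0) = U₀`: transition amplitudes can be computed at half time
  have hamp : ∀ i j, ⟪f.map U₁ j, e.map U₀ i⟫_ℂ
      = ⟪f j, WorkInterferometry.evolution ℏ H τ 0 (e i)⟫_ℂ := by
    intro i j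
    have h1 : U₀ (e i) = U₁ (WorkInterferometry.evolution ℏ K τ 0 (e i)) :=
      (congrArg (fun A : S →L[ℂ] S => A (e i))
        (WorkInterferometry.evolution_mul_evolution (ℏ := ℏ) hKint (τ / 2) τ 0)).symm
    rw [OrthonormalBasis.map_apply, OrthonormalBasis.map_apply, h1, U₁.inner_map_map, hU]
  have hW : Wdiss = β⁻¹ * ∑ i, ∑ j, ‖⟪f.map U₁ j, e.map U₀ i⟫_ℂ‖ ^ 2 *
      (p i * (Real.log (p i) - Real.log (q j))) := by
    rw [hWdiss, WorkInterferometry.avgDissipativeWork_workDistribution, Finset.mul_sum]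
    refine Finset.sum_congr rfl fun i _ => ?_
    rw [Finset.mul_sum]
    refine Finset.sum_congr rfl fun j _ => ?_
    simp only [hamp, hp, hq, Real.log_exp]
    field_simp
    ring
  have hVin : V = ‖⟪WorkInterferometry.pathOne ℏ τ Θ H ψ',
      WorkInterferometry.pathZero ℏ τ H ψ⟫_ℂ‖ :=
    hV.trans (WorkInterferometry.visibility_jointState _ _)
  rw [Fintype.card_fin, ← hVin] at hmain
  rw [hW, hβinv]
  exact ⟨mul_le_mul_of_nonneg_left hmain.1 (inv_nonneg.2 hβ0.le),
    mul_le_mul_of_nonneg_left hmain.2 (inv_nonneg.2 hβ0.le)⟩
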